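/- All graphs are finite and loopless and may have multiple edges. A signed graph $(G,\sigma)$ is a graph $G$ with a map $\sigma:E(G)\to\{+1,-1\}$; an edge $e$ is negative if $\sigma(e)=-1$. Each edge $e$ with ends $u,v$ consists of two half edges $h_e^u,h_e^v$, incident with $u$ and $v$ respectively; an orientation of $(G,\sigma)$ is a map $\tau$ from the set of half edges to $\{+1,-1\}$ with $\tau(h_e^u)\tau(h_e^v)=-\sigma(e)$ for every edge $e$ with ends $u,v$. For an integer $k\ge 2$, a nowhere-zero $k$-flow of $(G,\sigma)$ is a pair $(\tau,f)$ of an orientation $\tau$ and a function $f:E(G)\to\mathbb{Z}$ with $0<|f(e)|<k$ for every edge $e$ and $\sum_{e\ni v}\tau(h_e^v)f(e)=0$ for every vertex $v$, where the sum is over the edges incident with $v$. The signed graph $(G,\sigma)$ is flow-admissible if it admits a nowhere-zero $k$-flow for some integer $k\ge 2$. **Theorem 4.1.** Let $(G,\sigma)$ be a flow-admissible signed graph. Suppose that $(G,\sigma)$ has a spanning even Eulerian subgraph, that is, $G$ has a connected subgraph $H$ with $V(H)=V(G)$ in which every vertex has even degree and which contains an even number of negative edges. Then $(G,\sigma)$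 admits a nowhere-zero $6$-flow. -/

import Mathlib

open scoped Graph

namespace SignedGraph

variable {α β : Type*}

/-- A multigraph is connected if it has a vertex and any two of its vertices are joined by a walk. -/
def Connected (G : Graph α β) : Prop :=
  V(G).Nonempty ∧ ∀ x ∈ V(G), ∀ y ∈ V(G), Relation.ReflTransGen G.Adj x y

/-- The degree of a vertex of a finite loopless multigraph: the number of edges incident with it. -/
noncomputable def degree (G : Graph α β) (v : α) : ℕ :=
  {e | G.Inc e v}.ncard

/-- A graph is even if all its vertices have even degree. -/
def IsEven (G : Graph α β) : Prop :=
  ∀ v ∈ V(G), Even (degree G v)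

/-- An Eulerian graph is a connected even graph (it is not required to have an edge). -/
def IsEulerian (G : Graph α β) : Prop :=
  Connected G ∧ IsEven G

/-- The set of negative edges of the signed graph `(G, σ)`. Here and below a signature of `G` is a
map `σ : β → ℤˣ` to `{1, -1}`; only its values on the edges of `G` are ever used. -/
def negEdges (G : Graph α β) (σ : β → ℤˣ) : Set β :=
  {e | e ∈ E(G) ∧ σ e = -1}

/-- An even Eulerian signed graph: Eulerian, with an even number of negative edges. -/
def IsEvenEulerian (G : Graph α β) (σ : β → ℤˣ) : Prop :=
  IsEulerian G ∧ Even (negEdges G σ).ncard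

/-- An orientation of the loopless signed graph `(G, σ)`: each half edge, i.e. each incident pair
of an edge `e` and a vertex `v`, gets a sign `τ e v` (`+1`: away from `v`, `-1`: toward `v`), such
that the two half edges of every edge `e` have product `-σ e`. -/
def IsOrientation (G : Graph α β) (σ : β → ℤˣ) (τ : β → α → ℤˣ) : Prop :=
  ∀ e x y, G.IsLink e x y → τ e x * τ e y = -σ e

/-- The boundary of `f` at `v`: the sum of `τ h * f e` over the half edges `h` at `v`,
where `e` is the edge that contains `h`. -/
noncomputable def boundary (G : Graph α β) (τ : β → α → ℤˣ) (f : β → ℤ) (v : α) : ℤ :=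
  ∑ᶠ e ∈ {e | G.Inc e v}, (τ e v : ℤ) * f e

/-- `(τ, f)` is an (integer) `k`-flow of the signed graph `(G, σ)`. -/
structure IsFlow (G : Graph α β) (σ : β → ℤˣ) (k : ℕ) (τ : β → α → ℤˣ) (f : β → ℤ) : Prop where
  isOrientation : IsOrientation G σ τ
  boundary_eq_zero : ∀ v ∈ V(G), boundary G τ f v = 0
  abs_lt : ∀ e ∈ E(G), |f e| < k

/-- A nowhere-zero `k`-flow: a `k`-flow whose support consists of all edges. -/
structure IsNowhereZeroFlow (G : Graph α β) (σ : β → ℤˣ) (k : ℕ) (τ : β → α → ℤˣ) (f : β → ℤ) :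
    Prop extends IsFlow G σ k τ f where
  ne_zero : ∀ e ∈ E(G), f e ≠ 0

/-- `(G, σ)` admits a nowhere-zero `k`-flow. -/
def AdmitsNowhereZeroFlow (G : Graph α β) (σ : β → ℤˣ) (k : ℕ) : Prop :=
  ∃ (τ : β → α → ℤˣ) (f : β → ℤ), IsNowhereZeroFlow G σ k τ f

/-- `(G, σ)` is flow-admissible: it admits a nowhere-zero `k`-flow for some integer `k ≥ 2`. -/
def FlowAdmissible (G : Graph α β) (σ : β → ℤˣ) : Prop :=
  ∃ k : ℕ, 2 ≤ k ∧ AdmitsNowhereZeroFlow G σ k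

end SignedGraph

/-! Follow a closed Eulerian trail of `H` and let π(t) be the product of its first t edge signs; π
returns to 1 because `H` has evenly many negative edges. Choose one visit for each vertex and switch
by the value of π at that visit. The edges outside `H` become signed chords joining points on the
time line of the trail. Suppose the chord ends get values g of absolute value 1 or 2, opposite on
positive and equal on negative chords, with total 0 and with partial sums among six consecutive
integers. Let each outer edge carry 2g, and each trail edge, up to sign, a constant plus twice the
current partial sum. Summation by parts shows that this is a flow, and a suitable constant makes the
trail values odd and at most 5 in absolute value (`admitsNowhereZeroFlow_of_points`).

It remains to find g (`ChordSystem.exists_values`). Points are consumed in pairs from the end. Ends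
of two different chords get opposite signs and the chords fuse into one; a positive chord joining
the pair also gets opposite signs; a negative chord joining it gives a free step of ±2, a defect. So
the partial sums follow, up to 1, twice a ±1 walk that can be prescribed at will (`Reduces`). With
values ±1 the total is congruent mod 4 to twice the number of negative chords. If that number is
even, a walk alternating between 0 and 1 suffices. If it is odd and at least 3, one negative chord
gets the value 2 at both ends, the others get signs of total -4, and the walk is chosen to absorb
the jump at the second end (`BoundedAround`).

In the odd case there is another way out if the trail meets some vertex with both values of π: a
virtual negative chord between these two visits corrects the parity and contributes nothing to the
boundary. If neither way is open, switching leaves exactly one negative edge in `G`, which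
contradicts flow-admissibility. -/

namespace SignedGraph

/-! ### Chord systems and the removal of pairs of points -/

variable {ι : Type*}

/-- A system of signed chords on the points of a list `L`: the involution `m` maps every point to
the other end of its chord, and `σ` is the sign of the chord. -/
structure ChordSystem (L : List ι) (m : ι → ι) (σ : ι → ℤˣ) : Prop where
  mem : ∀ x ∈ L, m x ∈ L
  invol : ∀ x ∈ L, m (m x) = x
  ne : ∀ x ∈ L, m x ≠ x
  sign : ∀ x ∈ L, σ (m x) = σ x

/-- The orientations of a chord system: the two ends of a positive chord get opposite signs, those
of a negative chord get equal signs. -/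
def IsSigning (L : List ι) (m : ι → ι) (σ s : ι → ℤˣ) : Prop :=
  ∀ x ∈ L, s (m x) = -σ x * s x

/-- The sum of the signs of a list of points. -/
def signSum (s : ι → ℤˣ) (L : List ι) : ℤ :=
  (L.map fun x => (s x : ℤ)).sum

@[simp] lemma signSum_nil (s : ι → ℤˣ) : signSum s [] = 0 := rfl

@[simp] lemma signSum_cons (s : ι → ℤˣ) (a : ι) (L : List ι) :
    signSum s (a :: L) = s a + signSum s L := by simp [signSum]

@[simp] lemma signSum_append (s : ι → ℤˣ) (L L' : List ι) :
    signSum s (L ++ L') = signSum s L + signSum s L' := by simp [signSum]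

lemma signSum_congr {s t : ι → ℤˣ} {L : List ι} (h : ∀ x ∈ L, s x = t x) :
    signSum s L = signSum t L := by
  unfold signSum
  rw [List.map_congr_left]
  intro x hx
  rw [h x hx]

lemma units_int_cases (u : ℤˣ) : u = 1 ∨ u = -1 := Int.units_eq_one_or u

namespace ChordSystem

variable {L F T : List ι} {m : ι → ι} {σ : ι → ℤˣ} {a b : ι}

lemma of_mem_iff (h : ChordSystem L m σ) {L' : List ι} (hL : ∀ x, x ∈ L' ↔ x ∈ L) :
    ChordSystem L' m σ :=
  ⟨fun x hx => (hL _).2 (h.mem x ((hL x).1 hx)), fun x hx => h.invol x ((hL x).1 hx),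
    fun x hx => h.ne x ((hL x).1 hx), fun x hx => h.sign x ((hL x).1 hx)⟩

lemma eq_of_mate_eq (h : ChordSystem L m σ) {x y : ι} (hx : x ∈ L) (hy : y ∈ L)
    (hxy : m x = m y) : x = y := by
  rw [← h.invol x hx, hxy, h.invol y hy]

/-- Deleting a chord from a chord system. -/
lemma remove_chord (h : ChordSystem L m σ) {a : ι} {L' : List ι} (ha : a ∈ L)
    (hL : ∀ x, x ∈ L' ↔ x ∈ L ∧ x ≠ a ∧ x ≠ m a) : ChordSystem L' m σ := by
  refine ⟨fun x hx => ?_, fun x hx => h.invol x ((hL x).1 hx).1, fun x hx => h.ne x ((hL x).1 hx).1,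
    fun x hx => h.sign x ((hL x).1 hx).1⟩
  obtain ⟨hx, hxa, hxm⟩ := (hL x).1 hx
  refine (hL _).2 ⟨h.mem x hx, fun e => hxm ?_, fun e => hxa (h.eq_of_mate_eq hx ha e)⟩
  rw [← e, h.invol x hx]

/-- A list with a chord system is empty or has at least two points. -/
lemma eq_nil_or_concat_pair (h : ChordSystem L m σ) :
    L = [] ∨ ∃ F a b, L = F ++ [a, b] := by
  rcases List.eq_nil_or_concat L with rfl | ⟨L', b, rfl⟩
  · simp
  right
  rcases List.eq_nil_or_concat L' with rfl | ⟨F, a, rfl⟩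
  · have h1 := h.mem b (by simp)
    have h2 := h.ne b (by simp)
    simp_all
  · exact ⟨F, a, b, by simp⟩

variable [DecidableEq ι]

lemma exists_signing_of_mate (h : ChordSystem (F ++ [a, b]) m σ) (hd : (F ++ [a, b]).Nodup)
    (hab : m a = b) {s' : ι → ℤˣ} (hs : IsSigning F m σ s') (e : ℤˣ) :
    ∃ s, IsSigning (F ++ [a, b]) m σ s ∧ (∀ x ∈ F, s x = s' x) ∧ s a = e ∧ s b = -σ a * e := by
  have ha : a ∉ F := by grind
  have hb : b ∉ F := by grind
  have hne : a ≠ b := by grind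
  have hba : m b = a := by rw [← hab]; exact h.invol a (by simp)
  have hF : ChordSystem F m σ := h.remove_chord (a := a) (by simp) (by grind)
  refine ⟨fun x => if x = a then e else if x = b then -σ a * e else s' x, ?_, ?_, by simp,
    by simp [hne.symm]⟩
  · intro x hx
    simp only [List.mem_append, List.mem_cons, List.not_mem_nil, or_false] at hx
    rcases hx with hx | rfl | rfl
    · have h1 : x ≠ a := by grind
      have h2 : x ≠ b := by grind
      have h3 := hF.mem x hx
      have h4 : m x ≠ a := by grind
      have h5 : m x ≠ b := by grind
      simp only [h1, h2, h4, h5, if_false]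
      exact hs x hx
    · simp [hab, hne.symm]
    · have hσ : σ x = σ a := by rw [← hab]; exact h.sign a (by simp)
      simp only [hba, if_true, hne.symm, if_false, hσ]
      rcases units_int_cases (σ a) with h | h <;> simp [h]
  · intro x hx
    have h1 : x ≠ a := by grind
    have h2 : x ≠ b := by grind
    simp [h1, h2]

/-- Two chords with ends `a` and `b` are merged into one chord; every orientation of the new system
extends to one of the old system in which `a` and `b` have opposite signs. -/
lemma exists_merge (h : ChordSystem (F ++ [a, b]) m σ) (hd : (F ++ [a, b]).Nodup)
    (hab : m a ≠ b) : ∃ (m' : ι → ι) (σ' : ι → ℤˣ), ChordSystem F m' σ' ∧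
      σ' (m a) = σ a * σ b ∧ σ' (m b) = σ a * σ b ∧
      (∀ x ∈ F, x ≠ m a → x ≠ m b → σ' x = σ x) ∧
      ∀ s', IsSigning F m' σ' s' → ∃ s, IsSigning (F ++ [a, b]) m σ s ∧ (∀ x ∈ F, s x = s' x) ∧
        s b = -s a := by
  have ha : a ∉ F := by grind
  have hb : b ∉ F := by grind
  have hne : a ≠ b := by grind
  have haL : a ∈ F ++ [a, b] := by simp
  have hbL : b ∈ F ++ [a, b] := by simp
  have hqa := h.ne a haL
  have hrb := h.ne b hbL
  have hmq := h.invol a haL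
  have hmr := h.invol b hbL
  have hra : m b ≠ a := fun e => hab (by rw [← e, hmr])
  have hq : m a ∈ F := by have := h.mem a haL; grind
  have hr : m b ∈ F := by have := h.mem b hbL; grind
  have hqr : m a ≠ m b := fun e => hne (h.eq_of_mate_eq haL hbL e)
  have hmem : ∀ x ∈ F, x ≠ m a → x ≠ m b → m x ∈ F ∧ m x ≠ m a ∧ m x ≠ m b := by
    intro x hx h1 h2
    have hxL : x ∈ F ++ [a, b] := by simp [hx]
    have h3 := h.mem x hxL
    have h4 : m x ≠ a := fun e => h1 (by rw [← e, h.invol x hxL])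
    have h5 : m x ≠ b := fun e => h2 (by rw [← e, h.invol x hxL])
    refine ⟨by grind, fun e => ?_, fun e => ?_⟩
    · exact ha (h.eq_of_mate_eq hxL haL e ▸ hx)
    · exact hb (h.eq_of_mate_eq hxL hbL e ▸ hx)
  set q := m a with hqdef
  set r := m b with hrdef
  have hσq : σ q = σ a := h.sign a haL
  have hσr : σ r = σ b := h.sign b hbL
  refine ⟨fun x => if x = q then r else if x = r then q else m x,
    fun x => if x = q ∨ x = r then σ a * σ b else σ x, ⟨?_, ?_, ?_, ?_⟩, by simp, by simp, ?_, ?_⟩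
  · intro x hx
    by_cases h1 : x = q
    · simpa [h1] using hr
    by_cases h2 : x = r
    · simpa [h1, h2] using by split_ifs <;> assumption
    simpa [h1, h2] using (hmem x hx h1 h2).1
  · intro x hx
    by_cases h1 : x = q
    · simp [h1, hqr.symm]
    by_cases h2 : x = r
    · simp [h2, hqr.symm]
    obtain ⟨h3, h4, h5⟩ := hmem x hx h1 h2
    simpa [h1, h2, h4, h5] using h.invol x (by simp [hx])
  · intro x hx
    by_cases h1 : x = q
    · simpa [h1] using hqr.symm
    by_cases h2 : x = r
    · simpa [h2, hqr.symm] using hqr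
    simpa [h1, h2] using h.ne x (by simp [hx])
  · intro x hx
    by_cases h1 : x = q
    · simp [h1]
    by_cases h2 : x = r
    · simp [h2, hqr.symm]
    obtain ⟨h3, h4, h5⟩ := hmem x hx h1 h2
    simpa [h1, h2, h4, h5] using h.sign x (by simp [hx])
  · intro x hx h1 h2
    simp [h1, h2]
  · intro s' hs
    have hsr : s' r = -(σ a * σ b) * s' q := by simpa using hs q hq
    -- The signs at `a` and `b` are forced by their old mates; the product sign of the merged chord
    -- makes them opposite.
    refine ⟨fun x => if x = a then -σ a * s' q else if x = b then -σ b * s' r else s' x,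
      ?_, ?_, ?_⟩
    · intro x hx
      simp only [List.mem_append, List.mem_cons, List.not_mem_nil, or_false] at hx
      rcases hx with hx | rfl | rfl
      · have hxa : x ≠ a := by grind
        have hxb : x ≠ b := by grind
        by_cases h1 : x = q
        · rw [h1]; simp [hmq, hqa, hab, hσq]
        by_cases h2 : x = r
        · rw [h2]; simp [hmr, hra, hrb, hσr, hne.symm]
        obtain ⟨h3, h4, h5⟩ := hmem x hx h1 h2
        have h6 : m x ≠ a := by grind
        have h7 : m x ≠ b := by grind
        have := hs x hx
        simpa [h1, h2, h6, h7, hxa, hxb] using this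
      · simp only [← hqdef, hqa, hab, if_false, if_true]
        rcases units_int_cases (σ x) with h | h <;> simp [h]
      · simp only [← hrdef, hra, hrb, if_false, if_true, hne.symm]
        rcases units_int_cases (σ x) with h | h <;> simp [h]
    · intro x hx
      have hxa : x ≠ a := by grind
      have hxb : x ≠ b := by grind
      simp [hxa, hxb]
    · simp only [if_true, hne.symm, if_false, hsr]
      rcases units_int_cases (σ a) with h | h <;> rcases units_int_cases (σ b) with h' | h' <;>
        simp [h, h']

end ChordSystem

/-- The chord system `(m, σ)` on `F ++ T` reduces to `(m', σ')` on `F`: every orientation of the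
latter extends to the former such that the partial sums along `T` follow, up to `1`, a
prescribed sequence `2 * ℓ` with steps `± 2`; `d` tells the times of the steps. -/
def Reduces (m : ι → ι) (σ : ι → ℤˣ) (F T : List ι) (m' : ι → ι) (σ' : ι → ℤˣ) (d : ℕ → ℕ) : Prop :=
  Monotone d ∧ d 0 = 0 ∧ ∀ ℓ : ℕ → ℤ, ℓ 0 = 0 → (∀ i, |ℓ (i + 1) - ℓ i| = 1) →
    ∀ s', IsSigning F m' σ' s' → ∃ s, IsSigning (F ++ T) m σ s ∧ (∀ x ∈ F, s x = s' x) ∧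
      (∀ j ≤ T.length, |signSum s (T.take j) - 2 * ℓ (d j)| ≤ 1) ∧
      signSum s T = 2 * ℓ (d T.length)

namespace Reduces

variable {F T T' : List ι} {m m' m'' : ι → ι} {σ σ' σ'' : ι → ℤˣ} {a b : ι}

lemma refl (F : List ι) (m : ι → ι) (σ : ι → ℤˣ) : Reduces m σ F [] m σ 0 := by
  refine ⟨monotone_const, rfl, fun ℓ h0 _ s' hs => ⟨s', by simpa using hs, fun _ _ => rfl, ?_, ?_⟩⟩
  · simp [h0]
  · simp [h0]

/-- Defects add up: the sums along `T'` follow the same walk, restarted at the time `d T.length`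
reached at the end of `T`. -/
lemma trans {d d' : ℕ → ℕ} (h : Reduces m σ (F ++ T) T' m' σ' d')
    (h' : Reduces m' σ' F T m'' σ'' d) :
    Reduces m σ F (T ++ T') m'' σ'' (fun j => d (min j T.length) + d' (j - T.length)) := by
  obtain ⟨hm', h0', h'ext⟩ := h
  obtain ⟨hm, h0, hext⟩ := h'
  refine ⟨fun i j hij => Nat.add_le_add (hm (by grind)) (hm' (by grind)), by simp [h0, h0'], ?_⟩
  intro ℓ hℓ0 hℓ s'' hs''
  obtain ⟨s', hs', hs1, hs2, hs3⟩ := hext ℓ hℓ0 hℓ s'' hs''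
  obtain ⟨s, hs, ht1, ht2, ht3⟩ := h'ext (fun i => ℓ (d T.length + i) - ℓ (d T.length)) (by simp)
    (fun i => by simpa [add_assoc] using hℓ (d T.length + i)) s' hs'
  have hT : ∀ j, signSum s (T.take j) = signSum s' (T.take j) := fun j =>
    signSum_congr fun x hx => ht1 x (by simp [List.mem_of_mem_take hx])
  have hTT : signSum s T = signSum s' T := signSum_congr fun x hx => ht1 x (by simp [hx])
  refine ⟨s, by simpa using hs, fun x hx => ?_, fun j hj => ?_, ?_⟩
  · rw [ht1 x (by simp [hx]), hs1 x hx]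
  · dsimp only
    rcases le_total j T.length with hj' | hj'
    · rw [List.take_append_of_le_length hj', hT, min_eq_left hj', Nat.sub_eq_zero_of_le hj', h0']
      exact hs2 j hj'
    · rw [List.take_append, List.take_of_length_le hj', signSum_append, hTT, hs3, min_eq_right hj']
      have := ht2 (j - T.length) (by simp at hj; omega)
      convert this using 2
      ring
  · rw [signSum_append, hTT, hs3, ht3]
    simp
    ring

lemma of_opposite (h : ∀ s', IsSigning F m' σ' s' → ∃ s, IsSigning (F ++ [a, b]) m σ s ∧
    (∀ x ∈ F, s x = s' x) ∧ s b = -s a) : Reduces m σ F [a, b] m' σ' 0 := by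
  refine ⟨monotone_const, rfl, fun ℓ h0 _ s' hs => ?_⟩
  obtain ⟨s, h1, h2, h3⟩ := h s' hs
  refine ⟨s, h1, h2, fun j hj => ?_, by simp [h0, h3]⟩
  have hj : j ≤ 2 := hj
  interval_cases j
  · simp [h0]
  · rcases units_int_cases (s a) with h | h <;> simp [h0, h]
  · simp [h0, h3]

/-- The common sign of the two ends of a negative chord is free, so it can be taken as the next step
of the walk. After the first of the two points the sum has moved only half of the step of 2, which
costs the error 1 and explains `j / 2`. -/
lemma of_defect (h : ∀ s', IsSigning F m' σ' s' → ∀ e, ∃ s, IsSigning (F ++ [a, b]) m σ s ∧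
    (∀ x ∈ F, s x = s' x) ∧ s a = e ∧ s b = e) :
    Reduces m σ F [a, b] m' σ' (fun j => j / 2) := by
  refine ⟨fun i j hij => Nat.div_le_div_right hij, rfl, fun ℓ h0 hℓ s' hs => ?_⟩
  have h1 := hℓ 0
  rw [h0, sub_zero, zero_add] at h1
  obtain ⟨e, he⟩ : ∃ e : ℤˣ, (e : ℤ) = ℓ 1 := by
    rcases (abs_eq (by norm_num)).1 h1 with h | h
    · exact ⟨1, by simp [h]⟩
    · exact ⟨-1, by simp [h]⟩
  obtain ⟨s, h2, h3, h4, h5⟩ := h s' hs e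
  refine ⟨s, h2, h3, fun j hj => ?_, ?_⟩
  · have hj : j ≤ 2 := hj
    interval_cases j
    · simp [h0]
    · simp [h0, h4, he, h1]
    · simp [h4, h5, he, two_mul]
  · simp [h4, h5, he, two_mul]

end Reduces

end SignedGraph

/-! ### Parity of negative chords and balanced orientations -/

namespace SignedGraph

variable {ι : Type*} [DecidableEq ι] {L F T : List ι} {m : ι → ι} {σ s : ι → ℤˣ} {a b : ι}

/-- The number of ends of negative chords. -/
def negEnds (σ : ι → ℤˣ) (L : List ι) : ℤ :=
  (L.map fun x => if σ x = -1 then (1 : ℤ) else 0).sum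

namespace ChordSystem

/-- Positive chords never create a defect, and merging two of them gives a positive chord; the last
clause records this. -/
lemma exists_reduces_pair (h : ChordSystem (F ++ [a, b]) m σ) (hd : (F ++ [a, b]).Nodup) :
    ∃ m' σ' d, ChordSystem F m' σ' ∧ Reduces m σ F [a, b] m' σ' d ∧
      ((∀ x ∈ F ++ [a, b], σ x = 1) → (∀ x ∈ F, σ' x = 1) ∧ d 2 = 0) := by
  by_cases hab : m a = b
  · have hF : ChordSystem F m σ := h.remove_chord (a := a) (by simp) (by grind)
    rcases units_int_cases (σ a) with hσ | hσ
    · refine ⟨m, σ, 0, hF, Reduces.of_opposite fun s' hs => ?_, fun hp =>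
        ⟨fun x hx => hp x (by simp [hx]), rfl⟩⟩
      obtain ⟨s, h1, h2, h3, h4⟩ := h.exists_signing_of_mate hd hab hs 1
      exact ⟨s, h1, h2, by rw [h3, h4, hσ]; rfl⟩
    · refine ⟨m, σ, _, hF, Reduces.of_defect fun s' hs e => ?_, fun hp => ?_⟩
      · obtain ⟨s, h1, h2, h3, h4⟩ := h.exists_signing_of_mate hd hab hs e
        exact ⟨s, h1, h2, h3, by rw [h4, hσ]; simp⟩
      · have := hp a (by simp)
        rw [hσ] at this
        exact absurd this (by decide)
  · obtain ⟨m', σ', h1, h2, h3, h4, h5⟩ := h.exists_merge hd hab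
    refine ⟨m', σ', 0, h1, Reduces.of_opposite h5, fun hp => ⟨fun x hx => ?_, rfl⟩⟩
    have ha := hp a (by simp)
    have hb := hp b (by simp)
    by_cases hx1 : x = m a
    · rw [hx1, h2, ha, hb]; rfl
    by_cases hx2 : x = m b
    · rw [hx2, h3, ha, hb]; rfl
    rw [h4 x hx hx1 hx2, hp x (by simp [hx])]

lemma exists_reduces (n : ℕ) (hT : T.length = 2 * n) (h : ChordSystem (F ++ T) m σ)
    (hd : (F ++ T).Nodup) : ∃ m' σ' d, ChordSystem F m' σ' ∧ Reduces m σ F T m' σ' d ∧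
      ((∀ x ∈ F ++ T, σ x = 1) → (∀ x ∈ F, σ' x = 1) ∧ d T.length = 0) := by
  induction n generalizing T m σ with
  | zero =>
    obtain rfl : T = [] := by simpa using hT
    exact ⟨m, σ, 0, by simpa using h, Reduces.refl F m σ, fun hp => ⟨by simpa using hp, rfl⟩⟩
  | succ n ih =>
    obtain ⟨T', c, rfl⟩ : ∃ T' c, T = T' ++ [c] :=
      (List.eq_nil_or_concat T).resolve_left (by rintro rfl; simp at hT) |>.imp
        fun T' ⟨c, hc⟩ => ⟨c, by simpa using hc⟩
    obtain ⟨T, b, rfl⟩ : ∃ T c, T' = T ++ [c] :=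
      (List.eq_nil_or_concat T').resolve_left (by rintro rfl; simp at hT; omega) |>.imp
        fun T' ⟨c, hc⟩ => ⟨c, by simpa using hc⟩
    have e : F ++ (T ++ [b] ++ [c]) = (F ++ T) ++ [b, c] := by simp
    have e' : T ++ [b] ++ [c] = T ++ [b, c] := by simp
    rw [e] at h hd
    obtain ⟨m', σ', d', h1, h2, h3⟩ := h.exists_reduces_pair hd
    obtain ⟨m'', σ'', d, h4, h5, h6⟩ := ih (by simp at hT; omega) h1 (List.nodup_append.1 hd).1
    refine ⟨m'', σ'', _, h4, e' ▸ h2.trans h5, fun hp => ?_⟩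
    rw [e] at hp
    obtain ⟨h7, h8⟩ := h3 hp
    obtain ⟨h9, h10⟩ := h6 h7
    exact ⟨h9, by simp [h10, h8]⟩

lemma even_length (h : ChordSystem L m σ) (hd : L.Nodup) : Even L.length := by
  induction hn : L.length using Nat.strong_induction_on generalizing L m σ with
  | _ n ih =>
    subst hn
    rcases h.eq_nil_or_concat_pair with rfl | ⟨F, a, b, rfl⟩
    · simp
    obtain ⟨m', σ', d, h1, -, -⟩ := h.exists_reduces_pair hd
    have := ih F.length (by simp) h1 (List.nodup_append.1 hd).1 rfl
    simpa using this.add (by decide : Even 2)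

/-- Mod 4 each chord can be treated separately: the two ends of a positive chord sum to 0, those of
a negative chord to ±2, which is 2. -/
lemma signSum_eq_negEnds (h : ChordSystem L m σ) (hd : L.Nodup) (hs : IsSigning L m σ s) :
    (signSum s L : ZMod 4) = negEnds σ L := by
  have key : ∑ x ∈ L.toFinset, (((s x : ℤ) - if σ x = -1 then 1 else 0 : ℤ) : ZMod 4) = 0 := by
    refine Finset.sum_involution (fun x _ => m x) ?_ ?_ ?_ ?_
    · intro x hx
      have hx : x ∈ L := by simpa using hx
      rw [hs x hx, h.sign x hx]
      rcases units_int_cases (σ x) with h | h <;> rcases units_int_cases (s x) with h' | h' <;>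
        simp [h, h'] <;> decide
    · intro x hx _
      exact h.ne x (by simpa using hx)
    · intro x hx
      simpa using h.mem x (by simpa using hx)
    · intro x hx
      exact h.invol x (by simpa using hx)
  rw [List.sum_toFinset _ hd] at key
  have : (L.map fun x => (((s x : ℤ) - if σ x = -1 then 1 else 0 : ℤ) : ZMod 4)).sum
      = ((signSum s L - negEnds σ L : ℤ) : ZMod 4) := by
    clear h hd hs key
    unfold signSum negEnds
    induction L with
    | nil => simp
    | cons x L ih =>
      simp only [List.map_cons, List.sum_cons, ih]
      push_cast
      ring
  rw [this, Int.cast_sub, sub_eq_zero] at key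
  exact key

lemma dvd_signSum_iff (h : ChordSystem L m σ) (hd : L.Nodup) (hs : IsSigning L m σ s) :
    4 ∣ signSum s L ↔ 4 ∣ negEnds σ L := by
  have := h.signSum_eq_negEnds hd hs
  have h1 := ZMod.intCast_zmod_eq_zero_iff_dvd (signSum s L) 4
  have h2 := ZMod.intCast_zmod_eq_zero_iff_dvd (negEnds σ L) 4
  rw [this] at h1
  exact_mod_cast h1.symm.trans h2

lemma even_negEnds (h : ChordSystem L m σ) (hd : L.Nodup) : Even (negEnds σ L) := by
  have key : ∑ x ∈ L.toFinset, ((if σ x = -1 then 1 else 0 : ℤ) : ZMod 2) = 0 := by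
    refine Finset.sum_involution (fun x _ => m x) ?_ ?_ ?_ ?_
    · intro x hx
      have hx : x ∈ L := by simpa using hx
      rw [h.sign x hx]
      rcases units_int_cases (σ x) with h | h <;> simp [h] <;> decide
    · intro x hx _
      exact h.ne x (by simpa using hx)
    · intro x hx
      simpa using h.mem x (by simpa using hx)
    · intro x hx
      exact h.invol x (by simpa using hx)
  rw [List.sum_toFinset _ hd] at key
  have : (L.map fun x => ((if σ x = -1 then 1 else 0 : ℤ) : ZMod 2)).sum
      = ((negEnds σ L : ℤ) : ZMod 2) := by
    unfold negEnds
    rw [Int.cast_list_sum, List.map_map]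
    rfl
  rw [this] at key
  exact (ZMod.intCast_eq_zero_iff_even).1 key

/-- A chord system with an even number of negative chords has an orientation all of whose partial
sums lie between `-1` and `3`. -/
lemma exists_signing_of_four_dvd (h : ChordSystem L m σ) (hd : L.Nodup) (h4 : 4 ∣ negEnds σ L) :
    ∃ s, IsSigning L m σ s ∧ (∀ j, signSum s (L.take j) ∈ Set.Icc (-1) 3) ∧ signSum s L = 0 := by
  obtain ⟨n, hn⟩ := h.even_length hd
  obtain ⟨m', σ', d, h1, ⟨-, h0, h2⟩, -⟩ :=
    exists_reduces (F := []) (T := L) n (by omega) (by simpa using h) (by simpa using hd)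
  -- The walk alternates 0, 1, 0, 1, so the sums stay within 1 of 0 or 2 and end at 0 or 2;
  -- divisibility by 4 excludes 2.
  obtain ⟨s, hs, -, h3, h5⟩ := h2 (fun i => (i % 2 : ℕ)) (by simp)
    (fun i => by rw [abs_eq (by norm_num)]; omega) (fun _ => 1) (by simp [IsSigning])
  have hs : IsSigning L m σ s := by simpa using hs
  have h6 := (h.dvd_signSum_iff hd hs).2 h4
  have h7 : signSum s L = 0 := by omega
  refine ⟨s, hs, fun j => ?_, h7⟩
  rcases le_total j L.length with hj | hj
  · have := abs_le.1 (h3 j hj)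
    rw [Set.mem_Icc]
    omega
  · rw [List.take_of_length_le hj, h7]
    simp

/-- A chord system without negative chords has an orientation all of whose partial sums lie between
`-2` and `0`. -/
lemma exists_signing_of_pos (h : ChordSystem L m σ) (hd : L.Nodup) (hp : ∀ x ∈ L, σ x = 1) :
    ∃ s, IsSigning L m σ s ∧ (∀ j, signSum s (L.take j) ∈ Set.Icc (-2) 0) ∧ signSum s L = 0 := by
  rcases L with _ | ⟨x, L⟩
  · exact ⟨1, by simp [IsSigning], by simp, by simp⟩
  rcases List.eq_nil_or_concat L with rfl | ⟨mid, y, rfl⟩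
  · have h1 := h.mem x (by simp)
    have h2 := h.ne x (by simp)
    simp_all
  -- The first and last points are exempted from the reduction and end up as mates. Without negative
  -- chords there is no defect, so the sums along `mid` lie in [-1, 1]; the sign -1 at `x` shifts
  -- them to [-2, 0] and +1 at `y` restores the total 0.
  have hL : ∀ z, z ∈ [x, y] ++ mid ↔ z ∈ x :: mid.concat y := by intro z; simp; tauto
  have hd' : ([x, y] ++ mid).Nodup := by simp at hd ⊢; grind
  have hxy : x ≠ y := by simp at hd; grind
  obtain ⟨n, hn⟩ := h.even_length hd
  obtain ⟨m', σ', d, h1, ⟨hm, h0, h2⟩, h3⟩ :=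
    exists_reduces (F := [x, y]) (T := mid) (n - 1) (by simp at hn; omega) (h.of_mem_iff hL) hd'
  obtain ⟨h4, h5⟩ := h3 fun z hz => hp z ((hL z).1 hz)
  have hx : m' x = y := by
    have h1' := h1.mem x (by simp)
    have h2' := h1.ne x (by simp)
    simp_all
  have hy : m' y = x := by rw [← hx, h1.invol x (by simp)]
  obtain ⟨s, hs, h6, h7, h8⟩ := h2 (fun i => (i % 2 : ℕ)) (by simp)
    (fun i => by rw [abs_eq (by norm_num)]; omega) (fun z => if z = x then -1 else 1) (by
      intro z hz
      simp only [List.mem_cons, List.not_mem_nil, or_false] at hz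
      rcases hz with rfl | rfl
      · simp [hx, hxy.symm, h4]
      · simp [hy, hxy.symm, h4])
  have hsx : s x = -1 := by simp [h6]
  have hsy : s y = 1 := by simp [h6, hxy.symm]
  rw [h5] at h8
  have htot : signSum s (x :: mid.concat y) = 0 := by simp [hsx, hsy, h8]
  refine ⟨s, fun z hz => hs z ((hL z).2 hz), fun j => ?_, htot⟩
  rcases j with _ | j
  · simp
  rcases le_total j mid.length with hj | hj
  · rw [List.take_succ_cons, List.concat_eq_append, List.take_append_of_le_length hj,
      signSum_cons, hsx]
    have h9 := h7 j hj
    have h10 : d j = 0 := by have := hm hj; omega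
    rw [h10] at h9
    have := abs_le.1 h9
    simp at this ⊢
    omega
  · rcases hj.eq_or_lt with rfl | hj
    · simp [hsx, h8]
    · rw [List.take_of_length_le (by simp; omega), htot]
      simp

/-- Pairs of points are removed from the end of the list as long as a negative chord remains. -/
lemma exists_reduces_last (h : ChordSystem L m σ) (hd : L.Nodup) (hn : ∃ x ∈ L, σ x = -1) :
    ∃ F p p' T m' σ' d, L = F ++ [p, p'] ++ T ∧ Reduces m σ (F ++ [p, p']) T m' σ' d ∧
      ChordSystem (F ++ [p, p']) m' σ' ∧ σ' p = -1 ∧ σ' p' = -1 ∧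
      ((m' p = p' ∧ ∀ x ∈ F, σ' x = 1) ∨
        (m' p ≠ p' ∧ ∀ x ∈ F, x ≠ m' p → x ≠ m' p' → σ' x = 1)) := by
  induction hk : L.length using Nat.strong_induction_on generalizing L m σ with
  | _ n ih =>
    subst hk
    rcases h.eq_nil_or_concat_pair with rfl | ⟨F, a, b, rfl⟩
    · simp at hn
    have hdF := (List.nodup_append.1 hd).1
    have base : ∀ {m' σ' d}, ChordSystem F m' σ' → Reduces m σ F [a, b] m' σ' d →
        (∃ x ∈ F, σ' x = -1) → ∃ F_1 p p' T m' σ' d, F ++ [a, b] = F_1 ++ [p, p'] ++ T ∧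
      Reduces m σ (F_1 ++ [p, p']) T m' σ' d ∧
      ChordSystem (F_1 ++ [p, p']) m' σ' ∧ σ' p = -1 ∧ σ' p' = -1 ∧
      ((m' p = p' ∧ ∀ x ∈ F_1, σ' x = 1) ∨
        (m' p ≠ p' ∧ ∀ x ∈ F_1, x ≠ m' p → x ≠ m' p' → σ' x = 1)) := by
      intro m' σ' d h1 h2 h3
      obtain ⟨F', p, p', T, m'', σ'', d', rfl, h5, h6⟩ := ih F.length (by simp) h1 hdF h3 rfl
      exact ⟨F', p, p', T ++ [a, b], m'', σ'', _, by simp, h2.trans h5, h6⟩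
    by_cases hab : m a = b
    · have hσb : σ b = σ a := by rw [← hab, h.sign a (by simp)]
      by_cases hF : ∃ x ∈ F, σ x = -1
      · have hcs : ChordSystem F m σ := h.remove_chord (a := a) (by simp) (by grind)
        rcases units_int_cases (σ a) with hσ | hσ
        · refine base hcs (Reduces.of_opposite fun s' hs => ?_) hF
          obtain ⟨s, h1, h2, h3, h4⟩ := h.exists_signing_of_mate hd hab hs 1
          exact ⟨s, h1, h2, by rw [h3, h4, hσ]; rfl⟩
        · refine base hcs (Reduces.of_defect fun s' hs e => ?_) hF
          obtain ⟨s, h1, h2, h3, h4⟩ := h.exists_signing_of_mate hd hab hs e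
          exact ⟨s, h1, h2, h3, by rw [h4, hσ]; simp⟩
      · have hpos : ∀ x ∈ F, σ x = 1 := fun x hx =>
          (units_int_cases (σ x)).resolve_right fun e => hF ⟨x, hx, e⟩
        have hσa : σ a = -1 := by
          obtain ⟨x, hx, hx'⟩ := hn
          simp only [List.mem_append, List.mem_cons, List.not_mem_nil, or_false] at hx
          rcases hx with hx | rfl | rfl
          · exact absurd ⟨x, hx, hx'⟩ hF
          · exact hx'
          · rw [← hσb, hx']
        exact ⟨F, a, b, [], m, σ, 0, by simp, Reduces.refl _ _ _, h, hσa, by rw [hσb, hσa],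
          Or.inl ⟨hab, hpos⟩⟩
    · obtain ⟨m', σ', h1, h2, h3, h4, h5⟩ := h.exists_merge hd hab
      by_cases hF : ∃ x ∈ F, σ' x = -1
      · exact base h1 (Reduces.of_opposite h5) hF
      -- If the merge leaves no negative chord, the merged chord is positive, so the two chords at
      -- `a` and `b` have equal signs; these are negative since some chord was.
      · have hpos : ∀ x ∈ F, σ' x = 1 := fun x hx =>
          (units_int_cases (σ' x)).resolve_right fun e => hF ⟨x, hx, e⟩
        have hma : m a ∈ F := by
          have := h.mem a (by simp)
          have := h.ne a (by simp)
          grind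
        have hmb : m b ≠ a := fun e => hab (by rw [← e, h.invol b (by simp)])
        have hmul : σ a * σ b = 1 := by rw [← h2]; exact hpos _ hma
        have hσb : σ b = σ a := by
          rcases units_int_cases (σ a) with h | h <;> rcases units_int_cases (σ b) with h' | h' <;>
            simp_all
        have hpos' : ∀ x ∈ F, x ≠ m a → x ≠ m b → σ x = 1 := fun x hx hxa hxb => by
          rw [← h4 x hx hxa hxb, hpos x hx]
        have hσa : σ a = -1 := by
          obtain ⟨x, hx, hx'⟩ := hn
          by_contra hne
          have hσa := (units_int_cases (σ a)).resolve_right hne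
          have : σ x = 1 := by
            simp only [List.mem_append, List.mem_cons, List.not_mem_nil, or_false] at hx
            rcases hx with hx | rfl | rfl
            · by_cases hxa : x = m a
              · rw [hxa, h.sign a (by simp), hσa]
              by_cases hxb : x = m b
              · rw [hxb, h.sign b (by simp), hσb, hσa]
              exact hpos' x hx hxa hxb
            · exact hσa
            · rw [hσb, hσa]
          rw [hx'] at this
          exact absurd this (by decide)
        exact ⟨F, a, b, [], m, σ, 0, by simp, Reduces.refl _ _ _, by simpa using h, hσa,
          by rw [hσb, hσa], Or.inr ⟨hab, hpos'⟩⟩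

end ChordSystem

end SignedGraph

/-! ### Orientations of total -4 that absorb a jump at a given time -/

namespace SignedGraph

variable {ι : Type*} {L F K T : List ι} {m m' : ι → ι} {σ σ' s : ι → ℤˣ} {a b : ι}

/-- The orientation `s` of the points of `L` has total `-4`, and its partial sums, raised by `2` up
to time `t` and by `4` from time `t` on, stay in an interval of length `5`. -/
def BoundedAround (s : ι → ℤˣ) (L : List ι) (t : ℕ) : Prop :=
  signSum s L = -4 ∧ ∃ c : ℤ, (∀ j ≤ L.length, j ≤ t → signSum s (L.take j) + 2 ∈ Set.Icc c (c + 5)) ∧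
    ∀ j ≤ L.length, t ≤ j → signSum s (L.take j) + 4 ∈ Set.Icc c (c + 5)

lemma signSum_filter (s : ι → ℤˣ) (P : ι → Bool) (L : List ι) :
    signSum s L = signSum s (L.filter P) + signSum s (L.filter fun x => !P x) := by
  induction L with
  | nil => simp
  | cons x L ih =>
    cases hx : P x <;> simp [hx, ih] <;> ring

lemma signSum_eq_neg_length (h : ∀ x ∈ L, s x = -1) : signSum s L = -(L.length : ℤ) := by
  induction L with
  | nil => simp
  | cons x L ih =>
    rw [signSum_cons, ih fun y hy => h y (by simp [hy]), h x (by simp)]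
    push_cast [List.length_cons, Units.val_neg, Units.val_one]
    ring

/-- This turns the problem into the choice of a walk. Along `T` the bounds are tightened by 1 on
each side to allow for the error in `Reduces`, and divisibility by 4 selects the right one of the
possible final totals. -/
lemma exists_boundedAround_of_reduces [DecidableEq ι] {d : ℕ → ℕ} (h : ChordSystem (K ++ T) m σ)
    (hd : (K ++ T).Nodup) (h4 : 4 ∣ negEnds σ (K ++ T)) (hR : Reduces m σ K T m' σ' d)
    (hs : IsSigning K m' σ' s) (t : ℕ) (ℓ : ℕ → ℤ) (h0 : ℓ 0 = 0)
    (h1 : ∀ i, |ℓ (i + 1) - ℓ i| = 1) (c : ℤ)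
    (hK : ∀ j ≤ K.length, j ≤ t → signSum s (K.take j) + 2 ∈ Set.Icc c (c + 5))
    (hK' : ∀ j ≤ K.length, t ≤ j → signSum s (K.take j) + 4 ∈ Set.Icc c (c + 5))
    (hT : ∀ j ≤ T.length, K.length + j ≤ t →
      signSum s K + 2 * ℓ (d j) + 2 ∈ Set.Icc (c + 1) (c + 4))
    (hT' : ∀ j ≤ T.length, t ≤ K.length + j →
      signSum s K + 2 * ℓ (d j) + 4 ∈ Set.Icc (c + 1) (c + 4))
    (htot : 4 ∣ signSum s K + 2 * ℓ (d T.length) → signSum s K + 2 * ℓ (d T.length) = -4) :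
    ∃ s, IsSigning (K ++ T) m σ s ∧ BoundedAround s (K ++ T) t := by
  obtain ⟨-, -, hR⟩ := hR
  obtain ⟨s', hs', h2, h3, h5⟩ := hR ℓ h0 h1 s hs
  have hKs : ∀ j, signSum s' (K.take j) = signSum s (K.take j) := fun j =>
    signSum_congr fun x hx => h2 x (List.mem_of_mem_take hx)
  have hKK : signSum s' K = signSum s K := signSum_congr h2
  have hsum : signSum s' (K ++ T) = signSum s K + 2 * ℓ (d T.length) := by
    rw [signSum_append, hKK, h5]
  have hdvd := (h.dvd_signSum_iff hd hs').2 h4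
  rw [hsum] at hdvd
  refine ⟨s', hs', by rw [hsum, htot hdvd], c, fun j hj hjt => ?_, fun j hj hjt => ?_⟩
  · rcases le_total j K.length with hjK | hjK
    · rw [List.take_append_of_le_length hjK, hKs]
      exact hK j hjK hjt
    · obtain ⟨i, rfl⟩ := Nat.exists_eq_add_of_le hjK
      have hi : i ≤ T.length := by simpa using hj
      rw [List.take_length_add_append, signSum_append, hKK]
      have h6 := hT i hi hjt
      have h7 := abs_le.1 (h3 i hi)
      rw [Set.mem_Icc] at h6 ⊢
      omega
  · rcases le_total j K.length with hjK | hjK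
    · rw [List.take_append_of_le_length hjK, hKs]
      exact hK' j hjK hjt
    · obtain ⟨i, rfl⟩ := Nat.exists_eq_add_of_le hjK
      have hi : i ≤ T.length := by simpa using hj
      rw [List.take_length_add_append, signSum_append, hKK]
      have h6 := hT' i hi hjt
      have h7 := abs_le.1 (h3 i hi)
      rw [Set.mem_Icc] at h6 ⊢
      omega

lemma signSum_take_append_pair (s : ι → ℤˣ) (F : List ι) (p p' : ι) :
    (∀ j ≤ F.length, signSum s ((F ++ [p, p']).take j) = signSum s (F.take j)) ∧
    signSum s ((F ++ [p, p']).take (F.length + 1)) = signSum s F + s p ∧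
    signSum s ((F ++ [p, p']).take (F.length + 2)) = signSum s F + s p + s p' := by
  refine ⟨fun j hj => by rw [List.take_append_of_le_length hj], ?_, ?_⟩
  · rw [List.take_length_add_append]
    simp
  · rw [List.take_length_add_append]
    simp
    ring

lemma le_length_append_pair {F : List ι} {p p' : ι} {j : ℕ} (hj : j ≤ (F ++ [p, p']).length) :
    j ≤ F.length ∨ j = F.length + 1 ∨ j = F.length + 2 := by
  simp at hj
  omega

namespace ChordSystem

variable [DecidableEq ι]

/-- The negative chord on `p`, `p'` gets two signs -1, so `F ++ [p, p']` has total -2. The walk must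
be one level lower after time `t` than before it, to offset the raise from 2 to 4; the parity of the
defect count at `t` decides which levels are used. -/
lemma exists_boundedAround_of_mate {p p' : ι} {d : ℕ → ℕ}
    (h : ChordSystem (F ++ [p, p'] ++ T) m σ) (hd : (F ++ [p, p'] ++ T).Nodup)
    (h4 : 4 ∣ negEnds σ (F ++ [p, p'] ++ T)) (hR : Reduces m σ (F ++ [p, p']) T m' σ' d)
    (h' : ChordSystem (F ++ [p, p']) m' σ') (hp : σ' p = -1) (hpp : m' p = p')
    (hF : ∀ x ∈ F, σ' x = 1) (t : ℕ) (htL : t ≤ (F ++ [p, p'] ++ T).length) :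
    ∃ s, IsSigning (F ++ [p, p'] ++ T) m σ s ∧ BoundedAround s (F ++ [p, p'] ++ T) t := by
  have hdK := (List.nodup_append.1 hd).1
  have hdF := (List.nodup_append.1 hdK).1
  have hcF : ChordSystem F m' σ' := h'.remove_chord (a := p) (by simp) (by grind)
  obtain ⟨s₀, hs₀, hb, hs0⟩ := hcF.exists_signing_of_pos hdF hF
  obtain ⟨s, hs, hsF, hsp, hsp'⟩ := h'.exists_signing_of_mate hdK hpp hs₀ (-1)
  have hsp' : s p' = -1 := by rw [hsp', hp]; rfl
  obtain ⟨hK1, hK2, hK3⟩ := signSum_take_append_pair s F p p'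
  have hsF0 : signSum s F = 0 := by rw [signSum_congr hsF, hs0]
  have hK1 : ∀ j ≤ F.length, signSum s ((F ++ [p, p']).take j) ∈ Set.Icc (-2) 0 := by
    intro j hj
    rw [hK1 j hj, signSum_congr fun x hx => hsF x (List.mem_of_mem_take hx)]
    exact hb j
  have hK : signSum s (F ++ [p, p']) = -2 := by simp [hsF0, hsp, hsp']
  have hlen : (F ++ [p, p']).length = F.length + 2 := by simp
  simp only [hsp, hsp', hsF0] at hK2 hK3
  norm_num at hK2 hK3
  have hmono := hR.1
  have hd0 := hR.2.1
  simp only [Set.mem_Icc] at hK1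
  by_cases ht : t < (F ++ [p, p']).length
  -- The jump occurs before the tail, where the raised sums -2 + 2ℓ + 4 alternate between 2 and 0.
  · refine exists_boundedAround_of_reduces h hd h4 hR hs t (fun i => -(i % 2 : ℕ)) (by simp)
      (fun i => by rw [abs_eq (by norm_num)]; omega) (-1) ?_ ?_ ?_ ?_ ?_ <;>
      simp only [hK, Set.mem_Icc]
    · intro j hj _
      rcases le_length_append_pair hj with h | rfl | rfl
      · have := hK1 j h
        omega
      all_goals omega
    · intro j hj _
      rcases le_length_append_pair hj with h | rfl | rfl
      · have := hK1 j h
        omega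
      all_goals omega
    all_goals intros; omega
  rw [not_lt] at ht
  obtain ⟨t, rfl⟩ := Nat.exists_eq_add_of_le ht
  have htT : d t ≤ d T.length := hmono (by simp at htL ⊢; omega)
  have hlow : ∀ j, (F ++ [p, p']).length + j ≤ (F ++ [p, p']).length + t → d j ≤ d t :=
    fun j hj => hmono (by omega)
  have hupp : ∀ j, (F ++ [p, p']).length + t ≤ (F ++ [p, p']).length + j → d t ≤ d j :=
    fun j hj => hmono (by omega)
  have hK4 : ∀ j ≤ (F ++ [p, p']).length, (F ++ [p, p']).length + t ≤ j → j = F.length + 2 ∧ t = 0 :=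
    fun j hj htj => by omega
  rcases Nat.mod_two_eq_zero_or_one (d t) with hpar | hpar
  -- The walk is at 0 at time `d t`, so it can pass from levels 0, 1 to levels 0, -1; the raised
  -- sums are 0 or 2 on both sides.
  · refine exists_boundedAround_of_reduces h hd h4 hR hs _
      (fun i => if i ≤ d t then (i % 2 : ℕ) else -(i % 2 : ℕ)) (by simp)
      (fun i => by rw [abs_eq (by norm_num)]; split_ifs <;> omega) (-1) ?_ ?_ ?_ ?_ ?_ <;>
      simp only [hK, Set.mem_Icc]
    · intro j hj _
      rcases le_length_append_pair hj with h | rfl | rfl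
      · have := hK1 j h
        omega
      all_goals omega
    · intro j hj hj'
      obtain ⟨rfl, -⟩ := hK4 j hj hj'
      omega
    · intro j _ hj'
      have := hlow j hj'
      split_ifs; omega
    · intro j _ hj'
      have := hupp j hj'
      split_ifs <;> omega
    · split_ifs <;> omega
  -- The walk is at -1 at time `d t` and passes from levels 0, -1 to levels -1, -2; the raised sums
  -- are 0 or -2 on both sides.
  · refine exists_boundedAround_of_reduces h hd h4 hR hs _
      (fun i => if i ≤ d t then -(i % 2 : ℕ) else -1 - ((i + 1) % 2 : ℕ)) (by simp)
      (fun i => by rw [abs_eq (by norm_num)]; split_ifs <;> omega) (-3) ?_ ?_ ?_ ?_ ?_ <;>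
      simp only [hK, Set.mem_Icc]
    · intro j hj _
      rcases le_length_append_pair hj with h | rfl | rfl
      · have := hK1 j h
        omega
      all_goals omega
    · intro j hj hj'
      obtain ⟨rfl, rfl⟩ := hK4 j hj hj'
      omega
    · intro j _ hj'
      have := hlow j hj'
      split_ifs; omega
    · intro j _ hj'
      have := hupp j hj'
      split_ifs <;> omega
    · split_ifs <;> omega

/-- The signs `-1` on the four points `p`, `p'`, `m p`, `m p'` and a balanced orientation of the
positive chords. -/
lemma exists_signing_of_two_neg {p p' : ι} (h : ChordSystem (F ++ [p, p']) m σ)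
    (hd : (F ++ [p, p']).Nodup) (hp : σ p = -1) (hp' : σ p' = -1) (hpp : m p ≠ p')
    (hF : ∀ x ∈ F, x ≠ m p → x ≠ m p' → σ x = 1) :
    ∃ s, IsSigning (F ++ [p, p']) m σ s ∧ s p = -1 ∧ s p' = -1 ∧ ∃ c : ℕ → ℤ,
      (∀ j ≤ F.length, signSum s (F.take j) + c j ∈ Set.Icc (-2) 0) ∧ Monotone c ∧ 0 ≤ c 0 ∧
      (∀ j, c j ≤ 2) ∧ c F.length = 2 ∧ signSum s F = -2 := by
  have hdF := (List.nodup_append.1 hd).1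
  have hpK : p ∈ F ++ [p, p'] := by simp
  have hpK' : p' ∈ F ++ [p, p'] := by simp
  have hqp := h.ne p hpK
  have hrp := h.ne p' hpK'
  have hmq := h.invol p hpK
  have hmr := h.invol p' hpK'
  have hσq := h.sign p hpK
  have hσr := h.sign p' hpK'
  have hrp' : m p' ≠ p := fun e => hpp (by rw [← e, hmr])
  have hpne : p ≠ p' := by grind
  have hqr : m p ≠ m p' := fun e => hpne (h.eq_of_mate_eq hpK hpK' e)
  have hq : m p ∈ F := by have := h.mem p hpK; grind
  have hr : m p' ∈ F := by have := h.mem p' hpK'; grind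
  set q := m p with hqdef
  set r := m p' with hrdef
  let P : ι → Bool := fun x => decide (x ≠ q ∧ x ≠ r)
  have hmem : ∀ x, x ∈ F.filter P ↔ x ∈ F ++ [p, p'] ∧ x ≠ p ∧ x ≠ p' ∧ x ≠ q ∧ x ≠ r := by
    intro x
    have hpF : p ∉ F := by grind
    have hpF' : p' ∉ F := by grind
    simp only [List.mem_filter, P, decide_eq_true_eq, List.mem_append, List.mem_cons,
      List.not_mem_nil, or_false]
    grind
  have hcs : ChordSystem (F.filter P) m σ := by
    refine ⟨fun x hx => ?_, fun x hx => h.invol x ((hmem x).1 hx).1,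
      fun x hx => h.ne x ((hmem x).1 hx).1, fun x hx => h.sign x ((hmem x).1 hx).1⟩
    obtain ⟨hx, h1, h2, h3, h4⟩ := (hmem x).1 hx
    have hxx := h.invol x hx
    refine (hmem _).2 ⟨h.mem x hx, ?_, ?_, ?_, ?_⟩
    · exact fun e => h3 (by rw [← hxx, e])
    · exact fun e => h4 (by rw [← hxx, e])
    · exact fun e => h1 (by rw [← hxx, e, hmq])
    · exact fun e => h2 (by rw [← hxx, e, hmr])
  obtain ⟨s₀, hs₀, hb, hs0⟩ := hcs.exists_signing_of_pos (hdF.filter _) fun x hx => by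
    simp only [List.mem_filter, P, decide_eq_true_eq] at hx
    exact hF x hx.1 hx.2.1 hx.2.2
  let s : ι → ℤˣ := fun x => if x = p ∨ x = p' ∨ x = q ∨ x = r then -1 else s₀ x
  have hsP : ∀ x ∈ F.filter P, s x = s₀ x := fun x hx => by
    obtain ⟨-, h1, h2, h3, h4⟩ := (hmem x).1 hx
    simp [s, h1, h2, h3, h4]
  have hsN : ∀ j, ∀ x ∈ (F.take j).filter fun x => !P x, s x = -1 := fun j x hx => by
    simp only [List.mem_filter, P, Bool.not_eq_true', decide_eq_false_iff_not, not_and_or,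
      not_not] at hx
    rcases hx.2 with h | h <;> simp [s, h]
  -- This counts how many of `m p`, `m p'` are among the first `j` points; each lowers the balanced
  -- sums by 1.
  let c : ℕ → ℤ := fun j => (((F.take j).filter fun x => !P x).length : ℤ)
  have hsum : ∀ j, signSum s (F.take j) + c j = signSum s₀ ((F.take j).filter P) := fun j => by
    rw [signSum_filter s P, signSum_eq_neg_length (hsN j)]
    simp only [c, neg_add_cancel_right]
    exact signSum_congr fun x hx => hsP x (by
      simp only [List.mem_filter] at hx ⊢
      exact ⟨List.mem_of_mem_take hx.1, hx.2⟩)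
  have hmono : Monotone c := fun i j hij =>
    Nat.cast_le.2 (((List.take_prefix_take_left hij).filter _).length_le)
  have hcF : c F.length = 2 := by
    have : (F.filter fun x => !P x).Perm [q, r] := by
      rw [List.perm_ext_iff_of_nodup (hdF.filter _) (by simp [hqr])]
      intro x
      simp only [List.mem_filter, P, Bool.not_eq_true', decide_eq_false_iff_not, not_and_or,
        not_not, List.mem_cons, List.not_mem_nil, or_false]
      exact ⟨fun hx => hx.2, fun hx => ⟨by rcases hx with rfl | rfl <;> assumption, hx⟩⟩
    simp [c, this.length_eq]
  refine ⟨s, ?_, by simp [s], by simp [s], c, fun j _ => ?_, hmono, by simp [c], fun j => ?_, hcF, ?_⟩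
  · intro x hx
    by_cases hx1 : x = p
    · simp [s, hx1, ← hqdef, hp]
    by_cases hx2 : x = p'
    · simp [s, hx2, ← hrdef, hp']
    by_cases hx3 : x = q
    · simp [s, hx3, hmq, hσq, hp]
    by_cases hx4 : x = r
    · simp [s, hx4, hmr, hσr, hp']
    have hxF := (hmem x).2 ⟨hx, hx1, hx2, hx3, hx4⟩
    rw [hsP x hxF, hsP _ (hcs.mem x hxF)]
    exact hs₀ x hxF
  · rw [hsum, List.prefix_iff_eq_take.1 ((List.take_prefix j F).filter P)]
    exact hb _
  · rcases le_total j F.length with hj | hj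
    · exact (hmono hj).trans_eq hcF
    · have : c j = c F.length := by simp [c, List.take_of_length_le hj]
      rw [this, hcF]
  · have := hsum F.length
    rw [List.take_length, hs0, hcF] at this
    omega

/-- There are two ways to orient `F ++ [p, p']`: opposite signs at `p` and `p'`, with total 0, or -1
at all four ends of the two negative chords, with total -4. The first serves when `t` lies in the
tail at an odd defect count, the second otherwise. -/
lemma exists_boundedAround_of_two_neg {p p' : ι} {d : ℕ → ℕ}
    (h : ChordSystem (F ++ [p, p'] ++ T) m σ) (hd : (F ++ [p, p'] ++ T).Nodup)
    (h4 : 4 ∣ negEnds σ (F ++ [p, p'] ++ T)) (hR : Reduces m σ (F ++ [p, p']) T m' σ' d)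
    (h' : ChordSystem (F ++ [p, p']) m' σ') (hp : σ' p = -1) (hp' : σ' p' = -1) (hpp : m' p ≠ p')
    (hF : ∀ x ∈ F, x ≠ m' p → x ≠ m' p' → σ' x = 1) (t : ℕ)
    (htL : t ≤ (F ++ [p, p'] ++ T).length) :
    ∃ s, IsSigning (F ++ [p, p'] ++ T) m σ s ∧ BoundedAround s (F ++ [p, p'] ++ T) t := by
  have hdK := (List.nodup_append.1 hd).1
  have hdF := (List.nodup_append.1 hdK).1
  have hlen : (F ++ [p, p']).length = F.length + 2 := by simp
  have hmono := hR.1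
  have hd0 := hR.2.1
  by_cases hodd : (F ++ [p, p']).length ≤ t ∧ d (t - (F ++ [p, p']).length) % 2 = 1
  · obtain ⟨ht, hpar⟩ := hodd
    obtain ⟨t, rfl⟩ := Nat.exists_eq_add_of_le ht
    rw [Nat.add_sub_cancel_left] at hpar
    obtain ⟨m₁, σ₁, h1, h2, h3, h5, h6⟩ := h'.exists_merge hdK hpp
    obtain ⟨s₀, hs₀, hb, hs0⟩ := h1.exists_signing_of_pos hdF fun x hx => by
      by_cases hxp : x = m' p
      · rw [hxp, h2, hp, hp']; rfl
      by_cases hxp' : x = m' p'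
      · rw [hxp', h3, hp, hp']; rfl
      rw [h5 x hx hxp hxp', hF x hx hxp hxp']
    obtain ⟨s, hs, hsF, hsp⟩ := h6 s₀ hs₀
    have hspp : (s p' : ℤ) = -(s p : ℤ) := by rw [hsp]; simp
    obtain ⟨hK1, hK2, hK3⟩ := signSum_take_append_pair s F p p'
    have hsF0 : signSum s F = 0 := by rw [signSum_congr hsF, hs0]
    have hK1 : ∀ j ≤ F.length, signSum s ((F ++ [p, p']).take j) ∈ Set.Icc (-2) 0 := by
      intro j hj
      rw [hK1 j hj, signSum_congr fun x hx => hsF x (List.mem_of_mem_take hx)]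
      exact hb j
    have hK : signSum s (F ++ [p, p']) = 0 := by simp [hsF0, hspp]
    simp only [hspp, hsF0] at hK2 hK3
    have hspv : (s p : ℤ) = 1 ∨ (s p : ℤ) = -1 := by
      rcases units_int_cases (s p) with h | h <;> simp [h]
    simp only [Set.mem_Icc] at hK1
    have htT : d t ≤ d T.length := hmono (by simp at htL ⊢; omega)
    have hlow : ∀ j, (F ++ [p, p']).length + j ≤ (F ++ [p, p']).length + t → d j ≤ d t :=
      fun j hj => hmono (by omega)
    have hupp : ∀ j, (F ++ [p, p']).length + t ≤ (F ++ [p, p']).length + j → d t ≤ d j :=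
      fun j hj => hmono (by omega)
    -- From total 0 the levels 0, -1 before and -1, -2 after the jump give raised sums 0 or 2, and a
    -- final total of -2 or -4.
    refine exists_boundedAround_of_reduces h hd h4 hR hs _
      (fun i => if i ≤ d t then -(i % 2 : ℕ) else -1 - ((i + 1) % 2 : ℕ)) (by simp)
      (fun i => by rw [abs_eq (by norm_num)]; split_ifs <;> omega) (-1) ?_ ?_ ?_ ?_ ?_ <;>
      simp only [hK, Set.mem_Icc]
    · intro j hj _
      rcases le_length_append_pair hj with h | rfl | rfl
      · have := hK1 j h
        omega
      all_goals omega
    · intro j hj hj'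
      obtain ⟨rfl, rfl⟩ : t = 0 ∧ j = F.length + 2 := by omega
      omega
    · intro j _ hj'
      have := hlow j hj'
      split_ifs; omega
    · intro j _ hj'
      have := hupp j hj'
      split_ifs <;> omega
    · split_ifs <;> omega
  · obtain ⟨s, hs, hsp, hsp', c, hc, hcm, hc0, hc2, hcF, hsF0⟩ :=
      h'.exists_signing_of_two_neg hdK hp hp' hpp hF
    obtain ⟨hK1, hK2, hK3⟩ := signSum_take_append_pair s F p p'
    have hK1 : ∀ j ≤ F.length, signSum s ((F ++ [p, p']).take j) + c j ∈ Set.Icc (-2) 0 := by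
      intro j hj
      rw [hK1 j hj]
      exact hc j hj
    have hK : signSum s (F ++ [p, p']) = -4 := by simp [hsF0, hsp, hsp']
    simp only [hsp, hsp', hsF0] at hK2 hK3
    norm_num at hK2 hK3
    simp only [Set.mem_Icc] at hK1
    have hclow : ∀ j ≤ t, c j ≤ c t := fun j hj => hcm hj
    have hcupp : ∀ j, t ≤ j → c t ≤ c j := fun j hj => hcm hj
    have hcnn : ∀ j, 0 ≤ c j := fun j => hc0.trans (hcm (Nat.zero_le j))
    by_cases ht : t < (F ++ [p, p']).length
    -- The window depends on whether both `m p` and `m p'` precede the jump: if so the sums before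
    -- it can reach -2, if not those after it can reach 4.
    · refine exists_boundedAround_of_reduces h hd h4 hR hs t (fun i => (i % 2 : ℕ)) (by simp)
        (fun i => by rw [abs_eq (by norm_num)]; omega) (if c t = 2 then -2 else -1) ?_ ?_ ?_ ?_ ?_ <;>
        simp only [hK, Set.mem_Icc]
      · intro j hj hj'
        have h1 := hclow j hj'
        have h2 := hcnn j
        have h3 := hc2 t
        have h7 := hc2 j
        rcases le_length_append_pair hj with h | rfl | rfl
        · have := hK1 j h
          split_ifs <;> omega
        · have := hcm (Nat.le_succ F.length)
          simp only [Nat.succ_eq_add_one] at this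
          split_ifs <;> omega
        · omega
      · intro j hj hj'
        have h1 := hcupp j hj'
        have h2 := hcnn t
        have h3 := hc2 j
        rcases le_length_append_pair hj with h | rfl | rfl
        · have := hK1 j h
          split_ifs <;> omega
        all_goals split_ifs <;> omega
      · intros
        split_ifs <;> omega
      · intros
        split_ifs <;> omega
      · intro
        omega
    · rw [not_lt] at ht
      obtain ⟨t, rfl⟩ := Nat.exists_eq_add_of_le ht
      rw [Nat.add_sub_cancel_left] at hodd
      have htT : d t ≤ d T.length := hmono (by simp at htL ⊢; omega)
      have hlow : ∀ j, (F ++ [p, p']).length + j ≤ (F ++ [p, p']).length + t → d j ≤ d t :=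
        fun j hj => hmono (by omega)
      have hupp : ∀ j, (F ++ [p, p']).length + t ≤ (F ++ [p, p']).length + j → d t ≤ d j :=
        fun j hj => hmono (by omega)
      -- At an even defect count the walk is at 0 and can pass from levels 0, 1 to 0, -1; from total
      -- -4 the raised sums are 0 or -2 on both sides.
      refine exists_boundedAround_of_reduces h hd h4 hR hs _
        (fun i => if i ≤ d t then (i % 2 : ℕ) else -(i % 2 : ℕ)) (by simp)
        (fun i => by rw [abs_eq (by norm_num)]; split_ifs <;> omega) (-3) ?_ ?_ ?_ ?_ ?_ <;>
        simp only [hK, Set.mem_Icc]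
      · intro j hj _
        have h2 := hcnn j
        have h3 := hc2 j
        rcases le_length_append_pair hj with h | rfl | rfl
        · have := hK1 j h
          omega
        all_goals omega
      · intro j hj hj'
        obtain ⟨rfl, rfl⟩ : t = 0 ∧ j = F.length + 2 := by omega
        omega
      · intro j _ hj'
        have := hlow j hj'
        split_ifs; omega
      · intro j _ hj'
        have := hupp j hj'
        split_ifs <;> omega
      · split_ifs <;> omega

lemma exists_boundedAround (h : ChordSystem L m σ) (hd : L.Nodup) (h4 : 4 ∣ negEnds σ L)
    (hn : ∃ x ∈ L, σ x = -1) (t : ℕ) (ht : t ≤ L.length) :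
    ∃ s, IsSigning L m σ s ∧ BoundedAround s L t := by
  obtain ⟨F, p, p', T, m', σ', d, rfl, hR, h', hp, hp', ⟨hpp, hF⟩ | ⟨hpp, hF⟩⟩ :=
    h.exists_reduces_last hd hn
  · exact h.exists_boundedAround_of_mate hd h4 hR h' hp hpp hF t ht
  · exact h.exists_boundedAround_of_two_neg hd h4 hR h' hp hp' hpp hF t ht

/-- The ends of a chord system are given values `± 1` or `± 2`, opposite on positive chords and
equal on negative chords, with total `0` and with partial sums in an interval of length `5`. This
is possible unless there is exactly one negative chord. -/
theorem exists_values (h : ChordSystem L m σ) (hd : L.Nodup)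
    (hn : 4 ∣ negEnds σ L ∨ ∃ u ∈ L, ∃ x ∈ L, σ u = -1 ∧ σ x = -1 ∧ x ≠ u ∧ x ≠ m u) :
    ∃ g : ι → ℤ, (∀ x ∈ L, g (m x) = -σ x * g x ∧ g x ≠ 0 ∧ |g x| ≤ 2) ∧ (L.map g).sum = 0 ∧
      ∃ c : ℤ, ∀ j, ((L.take j).map g).sum ∈ Set.Icc c (c + 5) := by
  by_cases h4 : 4 ∣ negEnds σ L
  · obtain ⟨s, hs, hb, h0⟩ := h.exists_signing_of_four_dvd hd h4
    refine ⟨fun x => s x, fun x hx => ⟨?_, by simp, ?_⟩, h0, -1, fun j => ?_⟩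
    · show (s (m x) : ℤ) = -σ x * s x
      rw [hs x hx]
      push_cast
      ring
    · rcases units_int_cases (s x) with h | h <;> simp [h]
    · have := hb j
      unfold signSum at this
      rw [Set.mem_Icc] at this ⊢
      omega
  obtain ⟨u, hu, x, hx, hσu, hσx, hxu, hxm⟩ := hn.resolve_left h4
  -- The line is read cyclically from `u`. With the value 2 at `u` and `m u`, the sums of the other
  -- points are raised by 2 until `m u` and by 4 after it, and total -4 on the others gives total 0.
  -- Removing this chord makes the number of negative chords even, while `x` keeps it nonzero.
  obtain ⟨A, B, rfl⟩ := List.append_of_mem hu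
  have hmu := h.mem u hu
  have hne := h.ne u hu
  obtain ⟨X, Y, hXY⟩ : ∃ X Y, B ++ A = X ++ m u :: Y := List.append_of_mem (by
    simp only [List.mem_append, List.mem_cons] at hmu ⊢
    tauto)
  have hperm : (A ++ u :: B).Perm (u :: m u :: (X ++ Y)) := by
    refine List.perm_middle.trans (List.Perm.cons u ?_)
    exact (List.perm_append_comm.trans (by rw [hXY])).trans List.perm_middle
  have hd' := (hperm.nodup_iff).1 hd
  have hP : ChordSystem (X ++ Y) m σ := h.remove_chord hu fun z => by
    rw [hperm.mem_iff]
    grind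
  have hdP : (X ++ Y).Nodup := by grind
  have hneg : negEnds σ (A ++ u :: B) = 2 + negEnds σ (X ++ Y) := by
    unfold negEnds
    rw [(hperm.map _).sum_eq]
    simp [hσu, h.sign u hu]
    ring
  have heven := h.even_negEnds hd
  obtain ⟨s, hs, htot, c, hc1, hc2⟩ := hP.exists_boundedAround hdP (by grind)
    ⟨x, by have := hperm.mem_iff.1 hx; grind, hσx⟩ X.length (by simp)
  let g : ι → ℤ := fun z => if z = u ∨ z = m u then 2 else s z
  have hgP : ∀ z ∈ X ++ Y, g z = s z := fun z hz => by
    have h1 : z ≠ u := by grind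
    have h2 : z ≠ m u := by grind
    simp [g, h1, h2]
  have hgs : ∀ Z : List ι, (∀ z ∈ Z, z ∈ X ++ Y) → (Z.map g).sum = signSum s Z := fun Z hZ => by
    unfold signSum
    rw [List.map_congr_left fun z hz => hgP z (hZ z hz)]
  have hgu : g u = 2 := by simp [g]
  have hgv : g (m u) = 2 := by simp [g]
  have hXs := hgs X (by simp +contextual)
  have hYs := hgs Y (by simp +contextual)
  rw [signSum_append] at htot
  have hg0 : ((A ++ u :: B).map g).sum = 0 := by
    rw [(hperm.map g).sum_eq]
    simp only [List.map_cons, List.map_append, List.sum_cons, List.sum_append, hgu, hgv, hXs, hYs]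
    omega
  have hBA : ∀ j, 2 + (((B ++ A).take j).map g).sum ∈ Set.Icc c (c + 5) := by
    intro j
    rw [hXY]
    rcases le_or_gt j X.length with hj | hj
    · rw [List.take_append_of_le_length hj, hgs _ fun z hz => by
        simp [List.mem_of_mem_take hz]]
      have := hc1 j (by simp; omega) hj
      rw [List.take_append_of_le_length hj] at this
      rw [Set.mem_Icc] at this ⊢
      omega
    · obtain ⟨i, rfl⟩ : ∃ i, j = X.length + (i + 1) := ⟨j - X.length - 1, by omega⟩
      rw [List.take_length_add_append, List.take_succ_cons]
      simp only [List.map_cons, List.map_append, List.sum_cons, List.sum_append, hgv, hXs,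
        hgs (Y.take i) fun z hz => by simp [List.mem_of_mem_take hz]]
      have key : signSum s ((X ++ Y).take (X.length + min i Y.length)) + 4 ∈ Set.Icc c (c + 5) :=
        hc2 _ (by simp) (by simp)
      rw [List.take_length_add_append, signSum_append, ← List.take_eq_take_min] at key
      rw [Set.mem_Icc] at key ⊢
      omega
  have hAB : (A.map g).sum + 2 + (B.map g).sum = 0 := by
    simpa [hgu, add_assoc] using hg0
  -- As the total is 0, undoing the rotation only adds the constant `(A.map g).sum` to the partial
  -- sums.
  refine ⟨g, fun z hz => ?_, hg0, c + (A.map g).sum, fun j => ?_⟩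
  · rw [hperm.mem_iff] at hz
    simp only [List.mem_cons] at hz
    rcases hz with rfl | rfl | hz
    · simp [hgu, hgv, hσu]
    · rw [h.invol u hu, h.sign u hu]
      simp [hgu, hgv, hσu]
    · rw [hgP z hz, hgP _ (hP.mem z hz), hs z hz]
      refine ⟨by push_cast; ring, by simp, ?_⟩
      rcases units_int_cases (s z) with h | h <;> simp [h]
  · rcases le_or_gt j A.length with hj | hj
    · have := hBA (B.length + j)
      rw [List.take_length_add_append] at this
      rw [List.take_append_of_le_length hj]
      simp only [List.map_append, List.sum_append] at this
      rw [Set.mem_Icc] at this ⊢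
      omega
    · obtain ⟨i, rfl⟩ : ∃ i, j = A.length + (i + 1) := ⟨j - A.length - 1, by omega⟩
      rw [List.take_length_add_append, List.take_succ_cons, List.take_eq_take_min]
      have := hBA (min i B.length)
      rw [List.take_append_of_le_length (min_le_right _ _)] at this
      simp only [List.map_append, List.map_cons, List.sum_append, List.sum_cons, hgu]
      rw [Set.mem_Icc] at this ⊢
      omega

end ChordSystem

end SignedGraph

/-! ### Eulerian trails -/

namespace SignedGraph

variable {α β : Type*} {H : Graph α β} {n : ℕ} {z : ℕ → α} {e : ℕ → β}

/-- The edges `e 0, …, e (n - 1)` form a trail through the vertices `z 0, …, z n`. -/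
structure IsTrail (H : Graph α β) (n : ℕ) (z : ℕ → α) (e : ℕ → β) : Prop where
  start_mem : z 0 ∈ V(H)
  link : ∀ i < n, H.IsLink (e i) (z i) (z (i + 1))
  inj : Set.InjOn e (Set.Iio n)

namespace IsTrail

lemma le_ncard (h : IsTrail H n z e) (hE : E(H).Finite) : n ≤ E(H).ncard := by
  have := Set.ncard_le_ncard_of_injOn e (s := Set.Iio n) (t := E(H))
    (fun i hi => (h.link i hi).edge_mem) h.inj hE
  simpa using this

lemma mem (h : IsTrail H n z e) {i : ℕ} (hi : i ≤ n) : z i ∈ V(H) := by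
  rcases i with _ | i
  · exact h.start_mem
  · exact (h.link i hi).right_mem

lemma extend (h : IsTrail H n z e) {f : β} {y : α} (hf : H.IsLink f (z n) y)
    (hne : ∀ i < n, e i ≠ f) : ∃ z' e', IsTrail H (n + 1) z' e' := by
  refine ⟨fun i => if i ≤ n then z i else y, fun i => if i < n then e i else f,
    by simpa using h.start_mem, fun i hi => ?_, fun i hi j hj hij => ?_⟩
  · rcases (Nat.lt_succ_iff.1 hi).lt_or_eq with hi | rfl
    · have h1 : i + 1 ≤ n := hi
      simpa [hi, hi.le, h1] using h.link i hi
    · simpa using hf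
  · simp only [Set.mem_Iio] at hi hj
    by_cases h1 : i < n <;> by_cases h2 : j < n <;> simp only [h1, h2, if_true, if_false] at hij
    · exact h.inj h1 h2 hij
    · exact absurd hij (hne i h1)
    · exact absurd hij.symm (hne j h2)
    · omega

lemma rotate (h : IsTrail H n z e) (hc : z n = z 0) {k : ℕ} (hk : k < n) :
    IsTrail H n (fun i => z ((i + k) % n)) (fun i => e ((i + k) % n)) := by
  have hn : 0 < n := by omega
  refine ⟨h.mem (Nat.mod_lt _ hn).le, fun i hi => ?_, fun i hi j hj hij => ?_⟩
  · have h1 := h.link ((i + k) % n) (Nat.mod_lt _ hn)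
    have h2 : z ((i + k) % n + 1) = z ((i + 1 + k) % n) := by
      have h3 : (i + 1 + k) % n = ((i + k) % n + 1) % n := by simp [add_right_comm]
      rw [h3]
      rcases (Nat.succ_le_of_lt (Nat.mod_lt (i + k) hn)).lt_or_eq with h4 | h4
      · rw [Nat.mod_eq_of_lt h4]
      · rw [show (i + k) % n + 1 = n from h4, hc, Nat.mod_self]
    rwa [h2] at h1
  · have h1 := h.inj (Nat.mod_lt (i + k) hn) (Nat.mod_lt (j + k) hn) hij
    have h2 : i ≡ j [MOD n] := Nat.ModEq.add_right_cancel' k h1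
    exact Nat.ModEq.eq_of_lt_of_lt h2 hi hj

open Classical in
lemma sum_inc (h : IsTrail H n z e) [H.Loopless] (w : α) :
    ∑ i ∈ Finset.range n, (if H.Inc (e i) w then 1 else 0 : ZMod 2)
      = (if z 0 = w then 1 else 0) + if z n = w then 1 else 0 := by
  have hlink := h.link
  clear h
  induction n with
  | zero => split_ifs <;> simp; decide
  | succ n ih =>
    rw [Finset.sum_range_succ, ih fun i hi => hlink i (by omega)]
    have h1 := hlink n (by omega)
    have h2 := h1.ne
    have h3 : H.Inc (e n) w ↔ z n = w ∨ z (n + 1) = w := by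
      constructor
      · intro h
        rcases h.eq_or_eq_of_isLink h1 with h | h <;> simp [h]
      · rintro (rfl | rfl)
        exacts [h1.inc_left, h1.inc_right]
    have h4 : (1 + 1 : ZMod 2) = 0 := by decide
    by_cases h5 : z n = w <;> by_cases h6 : z (n + 1) = w
    · exact absurd (h5.trans h6.symm) h2
    all_goals simp [h3, h5, h6, add_assoc, h4]

/-- Otherwise the trail contains all edges at its last vertex, an even number; but a trail that is
not closed uses an odd number of edges there, by `sum_inc`. -/
lemma exists_unused_edge (h : IsTrail H n z e) [H.Loopless] (heven : IsEven H)
    (hc : z n ≠ z 0) : ∃ f y, H.IsLink f (z n) y ∧ ∀ i < n, e i ≠ f := by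
  classical
  by_contra! hall
  have hdeg := heven (z n) (h.mem le_rfl)
  have hset : {f | H.Inc f (z n)} =
      ((Finset.range n).filter fun i => H.Inc (e i) (z n)).image e := by
    ext f
    simp only [Set.mem_ofPred_eq, Finset.coe_image, Finset.coe_filter, Finset.mem_range,
      Set.mem_image]
    constructor
    · rintro ⟨y, hy⟩
      obtain ⟨i, hi, rfl⟩ := hall f y hy
      exact ⟨i, ⟨hi, y, hy⟩, rfl⟩
    · rintro ⟨i, ⟨-, hi⟩, rfl⟩
      exact hi
  rw [degree, hset, Set.ncard_coe_finset, Finset.card_image_of_injOn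
    (h.inj.mono fun i hi => by simp at hi; exact hi.1)] at hdeg
  have hsum := h.sum_inc (z n)
  rw [Finset.sum_boole, (ZMod.natCast_eq_zero_iff_even).2 hdeg] at hsum
  simp [hc.symm] at hsum

end IsTrail

lemma exists_step_of_reflTransGen {γ : Type*} {r : γ → γ → Prop} {x y : γ} {P : γ → Prop}
    (h : Relation.ReflTransGen r x y) (hx : P x) (hy : ¬P y) : ∃ u v, r u v ∧ P u ∧ ¬P v := by
  induction h with
  | refl => exact absurd hx hy
  | @tail b c _ hbc ih =>
    by_cases hb : P b
    · exact ⟨b, c, hbc, hb, hy⟩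
    · exact ih hb

/-- Every Eulerian graph has a closed trail through all its edges and vertices. -/
theorem exists_eulerian_trail [H.Loopless] (hH : IsEulerian H) (hE : E(H).Finite)
    (hne : E(H).Nonempty) : ∃ n z e, IsTrail H n z e ∧ 0 < n ∧ z n = z 0 ∧
      (∀ f ∈ E(H), ∃ i < n, e i = f) ∧ ∀ v ∈ V(H), ∃ i < n, z i = v := by
  classical
  obtain ⟨⟨⟨x, hx⟩, hconn⟩, heven⟩ := hH
  let P : ℕ → Prop := fun n => ∃ z e, IsTrail H n z e
  have hP0 : P 0 := ⟨fun _ => x, fun _ => hne.some, hx, by simp, by simp⟩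
  have hPb : ∀ n, P n → n ≤ E(H).ncard := fun n ⟨z, e, h⟩ => h.le_ncard hE
  obtain ⟨n, ⟨z, e, h⟩, hmax⟩ : ∃ n, P n ∧ ¬P (n + 1) := by
    by_contra! hc
    have : ∀ n, P n := fun n => Nat.rec hP0 (fun n ih => hc n ih) n
    have := hPb _ (this (E(H).ncard + 1))
    omega
  have hc : z n = z 0 := by
    by_contra hc
    obtain ⟨f, y, hf, hne⟩ := h.exists_unused_edge heven hc
    exact hmax (h.extend hf hne)
  -- A closed trail can be rotated to end at any of its vertices, where an unused edge would extend
  -- it.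
  have hins : ∀ i ≤ n, ∀ f y, H.IsLink f (z i) y → ∃ j < n, e j = f := by
    intro i hi f y hf
    by_contra! hun
    rcases hi.lt_or_eq with hi | rfl
    · have hr := h.rotate hc hi
      refine hmax (hr.extend (f := f) (y := y) ?_ fun j hj => hun _ (Nat.mod_lt _ (by omega)))
      simpa [Nat.mod_eq_of_lt hi] using hf
    · exact hmax (h.extend hf hun)
  have hvert : ∀ v ∈ V(H), ∃ i ≤ n, z i = v := by
    intro v hv
    by_contra hnot
    obtain ⟨u, w, ⟨f, hf⟩, ⟨i, hi, rfl⟩, hw⟩ := exists_step_of_reflTransGen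
      (P := fun v => ∃ i ≤ n, z i = v) (hconn (z 0) h.start_mem v hv) ⟨0, by omega, rfl⟩ hnot
    obtain ⟨j, hj, rfl⟩ := hins i hi f w hf
    rcases hf.right_eq_or_eq (h.link j hj) with rfl | rfl
    · exact hw ⟨j, hj.le, rfl⟩
    · exact hw ⟨j + 1, hj, rfl⟩
  have hedge : ∀ f ∈ E(H), ∃ i < n, e i = f := fun f hf => by
    obtain ⟨a, b, hab⟩ := H.exists_isLink_of_mem_edgeSet hf
    obtain ⟨i, hi, rfl⟩ := hvert a hab.left_mem
    exact hins i hi f b hab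
  obtain ⟨k, hk, -⟩ := hedge _ hne.some_mem
  refine ⟨n, z, e, h, by omega, hc, hedge, fun v hv => ?_⟩
  obtain ⟨i, hi, rfl⟩ := hvert v hv
  rcases hi.lt_or_eq with hi | rfl
  · exact ⟨i, hi, rfl⟩
  · exact ⟨0, by omega, hc.symm⟩

end SignedGraph

/-! ### Levels along the trail, flows on half edges, and the obstruction -/

namespace SignedGraph

section Levels

variable {ι : Type*} {L : List ι} {m : ι → ι} {σ : ι → ℤˣ}

lemma filter_eq_take {P : ι → Bool} (h : L.Pairwise fun x y => P y → P x) :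
    ∃ j, L.filter P = L.take j := by
  induction L with
  | nil => exact ⟨0, rfl⟩
  | cons x L ih =>
    rw [List.pairwise_cons] at h
    obtain ⟨j, hj⟩ := ih h.2
    by_cases hx : P x
    · exact ⟨j + 1, by simp [hx, hj]⟩
    · refine ⟨0, ?_⟩
      rw [List.take_zero, List.filter_eq_nil_iff]
      intro y hy hPy
      rcases List.mem_cons.1 hy with rfl | hy
      · exact hx hPy
      · exact hx (h.1 y hy hPy)

/-- If every point of a chord system has a position, the ends can be given values such that the
partial sums in the order of the positions determine odd levels between `-5` and `5`. -/
lemma ChordSystem.exists_levels [DecidableEq ι] (h : ChordSystem L m σ) (hd : L.Nodup)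
    (hn : 4 ∣ negEnds σ L ∨ ∃ u ∈ L, ∃ x ∈ L, σ u = -1 ∧ σ x = -1 ∧ x ≠ u ∧ x ≠ m u)
    (pos : ι → ℕ) : ∃ g : ι → ℤ, (∀ x ∈ L, g (m x) = -σ x * g x ∧ g x ≠ 0 ∧ |g x| ≤ 2) ∧
      (L.map g).sum = 0 ∧ ∃ c : ℤ, ∀ t, c + 2 * ((L.filter fun x => pos x ≤ t).map g).sum ≠ 0 ∧
        |c + 2 * ((L.filter fun x => pos x ≤ t).map g).sum| < 6 := by
  let r : ι → ι → Prop := fun x y => pos x ≤ pos y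
  have : Std.Total r := ⟨fun x y => le_total (pos x) (pos y)⟩
  have : IsTrans ι r := ⟨fun x y z => le_trans⟩
  have hperm := List.perm_insertionSort r L
  have hsort : (L.insertionSort r).Pairwise r := List.pairwise_insertionSort r L
  obtain ⟨g, h1, h2, c, h3⟩ := (h.of_mem_iff fun x => hperm.mem_iff).exists_values
    (hperm.nodup_iff.2 hd) (by
      have hneg : negEnds σ (L.insertionSort r) = negEnds σ L := (hperm.map _).sum_eq
      simpa only [hneg, hperm.mem_iff] using hn)
  -- The map y ↦ 2y - 2c - 5 sends c, …, c + 5 to the odd numbers -5, -3, …, 5.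
  refine ⟨g, fun x hx => h1 x (hperm.mem_iff.2 hx), by rw [← h2, (hperm.map g).sum_eq],
    -2 * c - 5, fun t => ?_⟩
  obtain ⟨j, hj⟩ := filter_eq_take (P := fun x => decide (pos x ≤ t))
    (hsort.imp fun {x y} (hxy : pos x ≤ pos y) hy => by simp at hy ⊢; omega)
  have h4 := h3 j
  rw [← hj, ((hperm.filter _).map g).sum_eq, Set.mem_Icc] at h4
  refine ⟨by omega, abs_lt.2 ⟨by omega, by omega⟩⟩

/-- Summation by parts: a point at position p contributes to all levels from time p on, and there
the differences of `A` telescope. -/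
lemma sum_range_sub_levels (A : ℕ → ℤ) (n : ℕ) (pos : ι → ℕ) (hpos : ∀ x ∈ L, pos x < n)
    (g : ι → ℤ) (c : ℤ) :
    ∑ t ∈ Finset.range n, (A t - A (t + 1)) * (c + 2 * ((L.filter fun x => pos x ≤ t).map g).sum)
      = c * (A 0 - A n) + 2 * (L.map fun x => (A (pos x) - A n) * g x).sum := by
  have hp : ∀ p n : ℕ, p ≤ n →
      ∑ t ∈ Finset.range n, (if p ≤ t then A t - A (t + 1) else 0) = A p - A n := by
    intro p n hpn
    induction n, hpn using Nat.le_induction with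
    | base =>
      rw [sub_self]
      exact Finset.sum_eq_zero fun t ht => if_neg (by simpa using ht)
    | succ n hpn ih => rw [Finset.sum_range_succ, ih, if_pos hpn]; ring
  induction L with
  | nil =>
    simp only [List.filter_nil, List.map_nil, List.sum_nil, mul_zero, add_zero]
    rw [← Finset.sum_mul, Finset.sum_range_sub', mul_comm]
  | cons x L ih =>
    have ih := ih fun y hy => hpos y (by simp [hy])
    have hx := hp (pos x) n (hpos x (by simp)).le
    have hterm : ∀ t, (A t - A (t + 1)) *
        (c + 2 * (((x :: L).filter fun x => pos x ≤ t).map g).sum) =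
        2 * g x * (if pos x ≤ t then A t - A (t + 1) else 0) + (A t - A (t + 1)) *
        (c + 2 * ((L.filter fun x => pos x ≤ t).map g).sum) := by
      intro t
      by_cases ht : pos x ≤ t
      · simp [ht]
        ring
      · simp [ht]
    rw [Finset.sum_congr rfl fun t _ => hterm t, Finset.sum_add_distrib, ih, ← Finset.mul_sum, hx]
    simp only [List.map_cons, List.sum_cons]
    ring

lemma sum_map_sub_mul (a g : ι → ℤ) (b : ℤ) (L : List ι) :
    (L.map fun x => (a x - b) * g x).sum = (L.map fun x => a x * g x).sum - b * (L.map g).sum := by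
  induction L with
  | nil => simp
  | cons x L ih =>
    simp only [List.map_cons, List.sum_cons, ih]
    ring

end Levels

variable {α β : Type*} {G H : Graph α β} {σ : β → ℤˣ}

open Classical in
/-- The end of the edge `e` other than `v`. -/
noncomputable def otherEnd (G : Graph α β) (e : β) (v : α) : α :=
  if h : G.Inc e v then h.other else v

lemma isLink_otherEnd {e : β} {v : α} (h : G.Inc e v) : G.IsLink e v (otherEnd G e v) := by
  rw [otherEnd, dif_pos h]
  exact h.isLink_other

lemma otherEnd_eq {e : β} {x y : α} (h : G.IsLink e x y) : otherEnd G e x = y :=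
  (isLink_otherEnd h.inc_left).right_unique h

open Classical in
lemma boundary_eq_sum (hE : E(G).Finite) (τ : β → α → ℤˣ) (f : β → ℤ) (v : α) :
    boundary G τ f v = ∑ e ∈ hE.toFinset, if G.Inc e v then (τ e v : ℤ) * f e else 0 := by
  have : {e | G.Inc e v} = ((hE.toFinset.filter fun e => G.Inc e v : Finset β) : Set β) := by
    ext e
    simp only [Finset.coe_filter, Set.Finite.mem_toFinset, Set.mem_ofPred_eq]
    exact ⟨fun h => ⟨h.edge_mem, h⟩, fun h => h.2⟩
  rw [boundary, this, finsum_mem_coe_finset, Finset.sum_filter]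

open Classical in
/-- A flow is given by the signed values on the half edges. -/
lemma admitsNowhereZeroFlow_of_halfEdges [G.Loopless] (hE : E(G).Finite) {k : ℕ} (φ : β → α → ℤ)
    (hlink : ∀ e x y, G.IsLink e x y → φ e y = -σ e * φ e x)
    (hne : ∀ e x, G.Inc e x → φ e x ≠ 0 ∧ |φ e x| < k)
    (hsum : ∀ v ∈ V(G), ∑ e ∈ hE.toFinset, (if G.Inc e v then φ e v else 0) = 0) :
    AdmitsNowhereZeroFlow G σ k := by
  by_cases hα : Nonempty α
  swap
  · refine ⟨fun _ _ => 1, fun _ => 0, ⟨fun e x => (hα ⟨x⟩).elim, fun v => (hα ⟨v⟩).elim, ?_⟩, ?_⟩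
    all_goals
      intro e he
      obtain ⟨x, -⟩ := G.exists_isLink_of_mem_edgeSet he
      exact (hα ⟨x⟩).elim
  -- Each edge gets a reference end with sign +1; the other end then has sign `-σ e`, and the flow
  -- value is read at the reference end.
  have hex : ∀ e, ∃ a, e ∈ E(G) → G.Inc e a := fun e => by
    by_cases he : e ∈ E(G)
    · obtain ⟨x, y, h⟩ := G.exists_isLink_of_mem_edgeSet he
      exact ⟨x, fun _ => h.inc_left⟩
    · exact ⟨hα.some, fun h => absurd h he⟩
  choose a ha using hex
  have hτ : ∀ e x, G.Inc e x → (((if x = a e then 1 else -σ e : ℤˣ)) : ℤ) * φ e (a e) = φ e x := by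
    intro e x hx
    by_cases hxa : x = a e
    · simp [hxa]
    · have hlk := (ha e hx.edge_mem).isLink_other
      rcases hx.eq_or_eq_of_isLink hlk with h | h
      · exact absurd h hxa
      · rw [← h] at hlk
        rw [if_neg hxa, hlink e _ _ hlk]
        simp
  refine ⟨fun e v => if v = a e then 1 else -σ e, fun e => φ e (a e), ⟨?_, fun v hv => ?_, ?_⟩, ?_⟩
  · intro e x y h
    have hxy := h.ne
    have h1 := (ha e h.edge_mem).eq_or_eq_of_isLink h
    rcases h1 with h1 | h1
    · simp [h1, hxy.symm]
    · simp [h1, hxy]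
  · rw [boundary_eq_sum hE]
    refine (Finset.sum_congr rfl fun e _ => ?_).trans (hsum v hv)
    split_ifs with h
    · have := hτ e v h
      rwa [if_pos ‹_›] at this
    · have := hτ e v h
      rwa [if_neg ‹_›] at this
    · rfl
  · exact fun e he => (hne e _ (ha e he)).2
  · exact fun e he => (hne e _ (ha e he)).1

open Classical in
/-- A flow-admissible signed graph is not equivalent, by switching at the vertices `v` with
`s v = -1`, to a signed graph with exactly one negative edge. -/
lemma not_exists_unique_neg_of_flowAdmissible [G.Loopless] (hV : V(G).Finite) (hE : E(G).Finite)
    (h : FlowAdmissible G σ) (s : α → ℤˣ) {e₀ : β} {x₀ y₀ : α} (h₀ : G.IsLink e₀ x₀ y₀)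
    (hneg : σ e₀ * s x₀ * s y₀ = -1)
    (hpos : ∀ e x y, G.IsLink e x y → e ≠ e₀ → σ e * s x * s y = 1) : False := by
  obtain ⟨k, -, τ, f, hf⟩ := h
  have h1 : ∑ v ∈ hV.toFinset, (s v : ℤ) * boundary G τ f v = 0 :=
    Finset.sum_eq_zero fun v hv => by rw [hf.boundary_eq_zero v (by simpa using hv), mul_zero]
  simp_rw [boundary_eq_sum hE, Finset.mul_sum] at h1
  rw [Finset.sum_comm] at h1
  have hedge : ∀ e x y, G.IsLink e x y →
      ∑ v ∈ hV.toFinset, (s v : ℤ) * (if G.Inc e v then (τ e v : ℤ) * f e else 0) =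
        (s x * τ e x + s y * τ e y) * f e := by
    intro e x y hxy
    have hsub : ({x, y} : Finset α) ⊆ hV.toFinset := by
      intro v hv
      rcases Finset.mem_insert.1 hv with rfl | hv
      · simpa using hxy.left_mem
      · rw [Finset.mem_singleton.1 hv]
        simpa using hxy.right_mem
    rw [← Finset.sum_subset hsub, Finset.sum_pair hxy.ne, if_pos hxy.inc_left,
      if_pos hxy.inc_right]
    · ring
    · intro v _ hv
      rw [if_neg, mul_zero]
      intro hinc
      apply hv
      rcases hinc.eq_or_eq_of_isLink hxy with rfl | rfl <;> simp
  -- In the switched sum of all boundaries the half edges of a positive edge cancel, while `e₀`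
  -- contributes ±2 times its nonzero value.
  rw [Finset.sum_eq_single e₀, hedge e₀ x₀ y₀ h₀] at h1
  · have h2 := hf.isOrientation e₀ x₀ y₀ h₀
    have h3 := hf.ne_zero e₀ h₀.edge_mem
    rcases units_int_cases (s x₀) with a | a <;> rcases units_int_cases (s y₀) with b | b <;>
      rcases units_int_cases (τ e₀ x₀) with c | c <;> rcases units_int_cases (τ e₀ y₀) with d | d <;>
      rcases units_int_cases (σ e₀) with e | e <;>
      simp [a, b, c, d, e] at h1 h2 hneg <;> omega
  · intro e he hne
    obtain ⟨x, y, hxy⟩ := G.exists_isLink_of_mem_edgeSet (by simpa using he)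
    rw [hedge e x y hxy]
    have h2 := hf.isOrientation e x y hxy
    have h3 := hpos e x y hxy hne
    rcases units_int_cases (s x) with a | a <;> rcases units_int_cases (s y) with b | b <;>
      rcases units_int_cases (τ e x) with c | c <;> rcases units_int_cases (τ e y) with d | d <;>
      rcases units_int_cases (σ e) with e | e <;>
      simp [a, b, c, d, e] at h2 h3 ⊢
  · intro he
    exact absurd h₀.edge_mem (by simpa using he)

end SignedGraph

/-! ### From the trail and its chords to a nowhere-zero 6-flow -/

namespace SignedGraph

variable {α β : Type*} {G H : Graph α β} {σ : β → ℤˣ} {n : ℕ} {z : ℕ → α} {e : ℕ → β}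

/-- The product of the signs of the first `t` edges of a trail. -/
def trailSign (σ : β → ℤˣ) (e : ℕ → β) (t : ℕ) : ℤˣ :=
  ∏ i ∈ Finset.range t, σ (e i)

lemma trailSign_succ (σ : β → ℤˣ) (e : ℕ → β) (t : ℕ) :
    trailSign σ e (t + 1) = trailSign σ e t * σ (e t) :=
  Finset.prod_range_succ _ _

lemma trailSign_eq_one (h : IsTrail H n z e) (hE : ∀ f ∈ E(H), ∃ i < n, e i = f)
    (heven : Even (negEdges H σ).ncard) : trailSign σ e n = 1 := by
  classical
  have hset : negEdges H σ = ((Finset.range n).filter fun i => σ (e i) = -1).image e := by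
    ext f
    simp only [negEdges, Set.mem_ofPred_eq, Finset.coe_image, Finset.coe_filter, Finset.mem_range,
      Set.mem_image]
    constructor
    · rintro ⟨hf, hσ⟩
      obtain ⟨i, hi, rfl⟩ := hE f hf
      exact ⟨i, ⟨hi, hσ⟩, rfl⟩
    · rintro ⟨i, ⟨hi, hσ⟩, rfl⟩
      exact ⟨(h.link i hi).edge_mem, hσ⟩
  rw [hset, Set.ncard_coe_finset, Finset.card_image_of_injOn
    (h.inj.mono fun i hi => by simp at hi; exact hi.1)] at heven
  have : ∀ i ∈ Finset.range n, σ (e i) = if σ (e i) = -1 then -1 else 1 := fun i _ => by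
    rcases units_int_cases (σ (e i)) with h | h <;> simp [h]
  rw [trailSign, Finset.prod_congr rfl this, Finset.prod_ite, Finset.prod_const, Finset.prod_const_one,
    mul_one, heven.neg_one_pow]

/-- The points `(e, v)` are the half edges outside the trail; two more points stand for a virtual
edge between two visits of the trail at the same vertex. -/
abbrev Point (α β : Type*) := (β × α) ⊕ Bool

noncomputable def Point.mate (G : Graph α β) : Point α β → Point α β :=
  Sum.elim (fun p => .inl (p.1, otherEnd G p.1 p.2)) fun b => .inr !b

/-- The sign of the edge of a point after switching at the vertices `v` with `s v = -1`; the virtual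
edge is negative. -/
noncomputable def Point.sign (G : Graph α β) (σ : β → ℤˣ) (s : α → ℤˣ) : Point α β → ℤˣ :=
  Sum.elim (fun p => σ p.1 * s p.2 * s (otherEnd G p.1 p.2)) fun _ => -1

lemma Point.sign_inl (s : α → ℤˣ) {f : β} {x y : α} (h : G.IsLink f x y) :
    Point.sign G σ s (.inl (f, x)) = σ f * s x * s y := by
  simp [Point.sign, otherEnd_eq h]

lemma Point.mate_inl {f : β} {x y : α} (h : G.IsLink f x y) :
    Point.mate G (.inl (f, x)) = .inl (f, y) := by
  simp [Point.mate, otherEnd_eq h]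

lemma chordSystem_points [G.Loopless] (s : α → ℤˣ) {L : List (Point α β)} {C : Set β} {B : Prop}
    (hL : ∀ f v, .inl (f, v) ∈ L ↔ f ∈ C ∧ G.Inc f v) (hB : ∀ b, .inr b ∈ L ↔ B) :
    ChordSystem L (Point.mate G) (Point.sign G σ s) := by
  have key : ∀ f v, .inl (f, v) ∈ L → f ∈ C ∧ ∃ w, G.IsLink f v w := fun f v h => (hL f v).1 h
  refine ⟨?_, ?_, ?_, ?_⟩ <;> rintro (⟨f, v⟩ | b) hx
  · obtain ⟨hf, w, h⟩ := key f v hx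
    rw [Point.mate_inl h]
    exact (hL f w).2 ⟨hf, h.inc_right⟩
  · exact (hB _).2 ((hB b).1 hx)
  · obtain ⟨hf, w, h⟩ := key f v hx
    rw [Point.mate_inl h, Point.mate_inl h.symm]
  · simp [Point.mate]
  · obtain ⟨hf, w, h⟩ := key f v hx
    rw [Point.mate_inl h]
    simpa using h.ne.symm
  · simp [Point.mate]
  · obtain ⟨hf, w, h⟩ := key f v hx
    rw [Point.mate_inl h, Point.sign_inl s h, Point.sign_inl s h.symm, mul_right_comm]
  · rfl

open Classical in
/-- Values on the points with bounded levels along a closed trail give a flow: an edge outside the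
trail carries twice the value of its points, an edge of the trail the level at its time. -/
lemma admitsNowhereZeroFlow_of_points [G.Loopless] (hHG : H ≤s G) (hV : V(G).Finite)
    (hE : E(G).Finite) (h : IsTrail H n z e) (hz : z n = z 0)
    (hEH : ∀ f ∈ E(H), ∃ i < n, e i = f) (hπ : trailSign σ e n = 1) {visit : α → ℕ}
    (hvisit : ∀ v ∈ V(G), visit v < n ∧ z (visit v) = v) {L₀ : List (β × α)} (hd₀ : L₀.Nodup)
    (hL₀ : ∀ f v, (f, v) ∈ L₀ ↔ f ∈ E(G) \ E(H) ∧ G.Inc f v) {X : List (Point α β)}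
    {i j : ℕ} (hi : i < n) (hj : j < n)
    (hX : X = [] ∨ X = [.inr true, .inr false] ∧ z i = z j ∧ trailSign σ e i ≠ trailSign σ e j)
    (hn : 4 ∣ negEnds (Point.sign G σ fun v => trailSign σ e (visit v)) (L₀.map .inl ++ X) ∨
      ∃ u ∈ L₀.map .inl ++ X, ∃ x ∈ L₀.map .inl ++ X,
        Point.sign G σ (fun v => trailSign σ e (visit v)) u = -1 ∧
        Point.sign G σ (fun v => trailSign σ e (visit v)) x = -1 ∧ x ≠ u ∧ x ≠ Point.mate G u) :
    AdmitsNowhereZeroFlow G σ 6 := by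
  set π := trailSign σ e with hπdef
  set s : α → ℤˣ := fun v => π (visit v) with hs
  set L : List (Point α β) := L₀.map .inl ++ X with hL
  have hinl : ∀ f v, Sum.inl (f, v) ∈ L ↔ f ∈ E(G) \ E(H) ∧ G.Inc f v := by
    intro f v
    rw [← hL₀]
    rcases hX with rfl | ⟨rfl, -⟩ <;> simp [hL]
  have hd : L.Nodup := by
    have := hd₀.map (Sum.inl_injective (β := Bool))
    rcases hX with rfl | ⟨rfl, -⟩
    · simpa [hL] using this
    · simp [hL, List.nodup_append, this]
  have hcs : ChordSystem L (Point.mate G) (Point.sign G σ s) :=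
    chordSystem_points s (B := X ≠ []) hinl fun b => by
      rcases hX with rfl | ⟨rfl, -⟩ <;> cases b <;> simp [hL]
  let pos : Point α β → ℕ := Sum.elim (fun p => visit p.2) fun b => if b then i else j
  obtain ⟨g, hg, hg0, c, hc⟩ := hcs.exists_levels hd hn pos
  set ℓ : ℕ → ℤ := fun t => c + 2 * ((L.filter fun x => pos x ≤ t).map g).sum with hℓ
  have hpos : ∀ x ∈ L, pos x < n := by
    rintro (⟨f, v⟩ | b) hx
    · exact (hvisit v ((hinl f v).1 hx).2.vertex_mem).1
    · cases b <;> simpa [pos]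
  -- The switching sign of the trail at time `t`, restricted to the visits at `v`.
  let A : α → ℕ → ℤ := fun v t => if z t = v then π t else 0
  have hπ0 : π 0 = 1 := by simp [hπdef, trailSign]
  have hA : ∀ v, A v 0 = A v n := fun v => by
    simp only [A, hz, hπ, hπ0]
  have hGH : ∀ {f x y}, H.IsLink f x y → G.IsLink f x y := fun hf => hHG.le.isLink_mono hf
  have hincG : ∀ t < n, ∀ v, G.Inc (e t) v ↔ z t = v ∨ z (t + 1) = v := by
    intro t ht v
    have hlk := hGH (h.link t ht)
    constructor
    · intro hv
      rcases hv.eq_or_eq_of_isLink hlk with h | h <;> simp [h]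
    · rintro (rfl | rfl)
      exacts [hlk.inc_left, hlk.inc_right]
  -- On a trail edge the difference of `A v` is `π t` at the tail, `-π (t + 1)` at the head and 0
  -- elsewhere, as the edge signs require. The factor -2 off the trail cancels the 2 in the levels.
  let φ : β → α → ℤ := fun f v =>
    if hf : ∃ t < n, e t = f then (A v hf.choose - A v (hf.choose + 1)) * ℓ hf.choose
    else -2 * (s v * g (.inl (f, v)))
  have hφH : ∀ t < n, ∀ v, φ (e t) v = (A v t - A v (t + 1)) * ℓ t := by
    intro t ht v
    have hex : ∃ t' < n, e t' = e t := ⟨t, ht, rfl⟩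
    have heq : hex.choose = t := h.inj hex.choose_spec.1 ht hex.choose_spec.2
    simp only [φ, dif_pos hex, heq]
  have hφz : ∀ t < n, φ (e t) (z t) = π t * ℓ t ∧ φ (e t) (z (t + 1)) = -(π t * σ (e t)) * ℓ t := by
    intro t ht
    have hne := (hGH (h.link t ht)).ne
    rw [hφH t ht, hφH t ht]
    simp [A, hne, hne.symm, hπdef, trailSign_succ]
  have hends : ∀ t < n, ∀ x y, G.IsLink (e t) x y →
      (x = z t ∧ y = z (t + 1)) ∨ (x = z (t + 1) ∧ y = z t) :=
    fun t ht x y hxy => hxy.eq_and_eq_or_eq_and_eq (hGH (h.link t ht))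
  have hφC : ∀ f ∉ E(H), ∀ v, φ f v = -2 * (s v * g (.inl (f, v))) := by
    intro f hf v
    have hex : ¬∃ t < n, e t = f := by
      rintro ⟨t, ht, rfl⟩
      exact hf (h.link t ht).edge_mem
    simp only [φ, dif_neg hex]
  refine admitsNowhereZeroFlow_of_halfEdges hE φ ?_ ?_ ?_
  · intro f x y hf
    by_cases hfH : f ∈ E(H)
    · obtain ⟨t, ht, rfl⟩ := hEH f hfH
      obtain ⟨h1, h2⟩ := hφz t ht
      rcases hends t ht x y hf with ⟨rfl, rfl⟩ | ⟨rfl, rfl⟩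
      · rw [h1, h2]
        ring
      · rw [h1, h2]
        rcases units_int_cases (σ (e t)) with h | h <;> simp [h]
    · have hgx := (hg (.inl (f, x)) ((hinl f x).2 ⟨⟨hf.edge_mem, hfH⟩, hf.inc_left⟩)).1
      rw [Point.mate_inl hf, Point.sign_inl s hf] at hgx
      rw [hφC f hfH, hφC f hfH, hgx]
      rcases units_int_cases (s y) with h | h <;> simp [h] <;> ring
  · intro f x hf
    by_cases hfH : f ∈ E(H)
    · obtain ⟨t, ht, rfl⟩ := hEH f hfH
      obtain ⟨h1, h2⟩ := hφz t ht
      obtain ⟨h3, h4⟩ : ℓ t ≠ 0 ∧ |ℓ t| < 6 := hc t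
      obtain ⟨y, hy⟩ := hf
      rcases hends t ht x y hy with ⟨rfl, rfl⟩ | ⟨rfl, rfl⟩
      · rw [h1]
        rcases units_int_cases (π t) with h | h <;> simpa [h, h3] using h4
      · rw [h2]
        rcases units_int_cases (π t) with h | h <;>
          rcases units_int_cases (σ (e t)) with h' | h' <;> simpa [h, h', h3] using h4
    · obtain ⟨-, h1, h2⟩ := hg (.inl (f, x)) ((hinl f x).2 ⟨⟨hf.edge_mem, hfH⟩, hf⟩)
      rw [hφC f hfH]
      rw [abs_le] at h2
      rw [abs_lt]
      rcases units_int_cases (s x) with h | h <;> simp [h] <;> omega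
  · intro v hv
    have hHfin : E(H).Finite := hE.subset hHG.le.edgeSet_mono
    have himage : hHfin.toFinset = (Finset.range n).image e := by
      ext f
      simp only [Set.Finite.mem_toFinset, Finset.mem_image, Finset.mem_range]
      exact ⟨hEH f, by rintro ⟨t, ht, rfl⟩; exact (h.link t ht).edge_mem⟩
    have hsub : hHfin.toFinset ⊆ hE.toFinset := by simpa using hHG.le.edgeSet_mono
    rw [← Finset.sum_sdiff hsub]
    have hsumH : ∑ f ∈ hHfin.toFinset, (if G.Inc f v then φ f v else 0) =
        2 * (L.map fun x => A v (pos x) * g x).sum := by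
      rw [himage, Finset.sum_image (by simpa using h.inj)]
      have : ∀ t ∈ Finset.range n, (if G.Inc (e t) v then φ (e t) v else 0) =
          (A v t - A v (t + 1)) * ℓ t := by
        intro t ht
        rw [Finset.mem_range] at ht
        rw [hφH t ht]
        split_ifs with hinc
        · rfl
        · rw [hincG t ht, not_or] at hinc
          simp [A, hinc.1, hinc.2]
      -- The constant of the levels drops out since the trail closes up with sign 1; the term in `A
      -- v n` drops out since the values of `g` have total 0.
      rw [Finset.sum_congr rfl this, sum_range_sub_levels (A v) n pos hpos g c, hA, sub_self, mul_zero,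
        zero_add]
      rw [sum_map_sub_mul, hg0, mul_zero, sub_zero]
    have hsumL : (L.map fun x => A v (pos x) * g x).sum =
        ∑ f ∈ hE.toFinset \ hHfin.toFinset, if G.Inc f v then s v * g (.inl (f, v)) else 0 := by
      -- The virtual ends have equal values and lie at visits of one vertex with opposite switching
      -- signs, so they cancel.
      have hXsum : (X.map fun x => A v (pos x) * g x).sum = 0 := by
        rcases hX with rfl | ⟨rfl, hij, hπij⟩
        · simp
        have hgv : g (.inr false) = g (.inr true) := by
          have := (hg (.inr true) (by simp [hL])).1
          simpa [Point.mate, Point.sign] using this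
        have hπj : π j = -π i := by
          rcases units_int_cases (π i) with h1 | h1 <;> rcases units_int_cases (π j) with h2 | h2 <;>
            rw [h1, h2] at hπij ⊢ <;> simp at hπij ⊢
        simp only [List.map_cons, List.map_nil, List.sum_cons, List.sum_nil, hgv, A, pos, hij, hπj,
          Sum.elim_inr, if_true, Bool.false_eq_true, if_false]
        split_ifs <;> simp
      have hfin : L₀.toFinset = ((hE.toFinset \ hHfin.toFinset) ×ˢ hV.toFinset).filter
          fun p => G.Inc p.1 p.2 := by
        ext ⟨f, w⟩
        simp only [List.mem_toFinset, hL₀, Finset.mem_filter, Finset.mem_product, Finset.mem_sdiff,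
          Set.Finite.mem_toFinset, Set.mem_sdiff]
        exact ⟨fun ⟨h1, h2⟩ => ⟨⟨h1, h2.vertex_mem⟩, h2⟩, fun ⟨⟨h1, _⟩, h2⟩ => ⟨h1, h2⟩⟩
      rw [hL, List.map_append, List.sum_append, hXsum, add_zero, List.map_map,
        ← List.sum_toFinset _ hd₀, hfin, Finset.sum_filter, Finset.sum_product]
      refine Finset.sum_congr rfl fun f _ => ?_
      rw [Finset.sum_eq_single v]
      · simp [A, pos, (hvisit v hv).2, hs]
      · intro w hw hwv
        have hzw : z (visit w) = w := (hvisit w (by simpa using hw)).2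
        simp [A, pos, hzw, hwv]
      · intro hv'
        exact absurd hv (by simpa using hv')
    rw [hsumH, hsumL, Finset.mul_sum, ← Finset.sum_add_distrib]
    refine Finset.sum_eq_zero fun f hf => ?_
    have hfH : f ∉ E(H) := by simp at hf; exact hf.2
    rw [hφC f hfH]
    split_ifs <;> ring

theorem admitsNowhereZeroFlow_six [G.Loopless] (hV : V(G).Finite) (hE : E(G).Finite)
    (hadm : FlowAdmissible G σ) (hHG : H ≤s G) (hH : IsEvenEulerian H σ) :
    AdmitsNowhereZeroFlow G σ 6 := by
  classical
  have hHl : H.Loopless := Graph.Loopless.anti hHG.le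
  have hHfin : E(H).Finite := hE.subset hHG.le.edgeSet_mono
  by_cases hne : E(H).Nonempty
  swap
  -- If `H` has no edge, connectedness leaves a single vertex, and a loopless graph on it has no
  -- edges.
  · have hadj : ∀ x y, x ∈ V(G) → y ∈ V(G) → x = y := by
      intro x y hx hy
      rw [← hHG.vertexSet_eq] at hx hy
      have := hH.1.1.2 x hx y hy
      induction this with
      | refl => rfl
      | tail _ hbc _ =>
        obtain ⟨f, hf⟩ := hbc
        exact absurd ⟨f, hf.edge_mem⟩ hne
    have hlink : ∀ f x y, ¬G.IsLink f x y := fun f x y hf =>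
      hf.ne (hadj x y hf.left_mem hf.right_mem)
    exact admitsNowhereZeroFlow_of_halfEdges hE (fun _ _ => 0)
      (fun f x y hf => absurd hf (hlink f x y))
      (fun f x hf => absurd hf.isLink_other (hlink f x _)) (by simp)
  obtain ⟨n, z, e, h, hn0, hz, hEH, hVH⟩ := exists_eulerian_trail hH.1 hHfin hne
  have hπ := trailSign_eq_one h hEH hH.2
  rw [hHG.vertexSet_eq] at hVH
  have hvis : ∀ v, ∃ i, v ∈ V(G) → i < n ∧ z i = v := fun v => by
    by_cases hv : v ∈ V(G)
    · obtain ⟨i, hi⟩ := hVH v hv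
      exact ⟨i, fun _ => hi⟩
    · exact ⟨0, fun h => absurd h hv⟩
  choose visit hvisit using hvis
  set s : α → ℤˣ := fun v => trailSign σ e (visit v) with hs
  let L₀ : List (β × α) := (((hE.toFinset \ hHfin.toFinset) ×ˢ hV.toFinset).filter
    fun p => G.Inc p.1 p.2).toList
  have hL₀ : ∀ f v, (f, v) ∈ L₀ ↔ f ∈ E(G) \ E(H) ∧ G.Inc f v := by
    intro f v
    simp only [L₀, Finset.mem_toList, Finset.mem_filter, Finset.mem_product, Finset.mem_sdiff,
      Set.Finite.mem_toFinset, Set.mem_sdiff]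
    exact ⟨fun ⟨⟨h1, _⟩, h2⟩ => ⟨h1, h2⟩, fun ⟨h1, h2⟩ => ⟨⟨h1, h2.vertex_mem⟩, h2⟩⟩
  have hd₀ : L₀.Nodup := Finset.nodup_toList _
  have main := fun X i j => admitsNowhereZeroFlow_of_points hHG hV hE h hz hEH hπ hvisit hd₀ hL₀
    (X := X) (i := i) (j := j)
  have hcs : ChordSystem (L₀.map .inl) (Point.mate G) (Point.sign G σ s) :=
    chordSystem_points s (B := False) (C := E(G) \ E(H)) (by simpa using hL₀) (by simp)
  have hd : (L₀.map (Sum.inl (β := Bool))).Nodup := hd₀.map Sum.inl_injective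
  by_cases h4 : 4 ∣ negEnds (Point.sign G σ s) (L₀.map .inl)
  · exact main [] 0 0 hn0 hn0 (Or.inl rfl) (Or.inl (by simpa using h4))
  by_cases hbal : ∃ i < n, ∃ j < n, z i = z j ∧ trailSign σ e i ≠ trailSign σ e j
  · obtain ⟨i, hi, j, hj, hij⟩ := hbal
    -- The number of negative chords is odd, and the virtual one makes it even.
    refine main [.inr true, .inr false] i j hi hj (Or.inr ⟨rfl, hij⟩) (Or.inl ?_)
    have heven := hcs.even_negEnds hd
    have : negEnds (Point.sign G σ s) (L₀.map .inl ++ [.inr true, .inr false]) =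
        negEnds (Point.sign G σ s) (L₀.map .inl) + 2 := by
      simp [negEnds, Point.sign]
    rw [this]
    grind
  push Not at hbal
  -- All visits at a vertex now agree in sign, so the switching makes every edge of `H` positive.
  have hstep : ∀ t < n, s (z t) = trailSign σ e t := fun t ht =>
    have hv := hvisit (z t) (hHG.vertexSet_eq ▸ (h.link t ht).left_mem)
    hbal _ hv.1 t ht hv.2
  have hstep' : ∀ t ≤ n, s (z t) = trailSign σ e t := fun t ht => by
    rcases ht.lt_or_eq with ht | rfl
    · exact hstep t ht
    · rw [hz, hstep 0 hn0, hπ]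
      simp [trailSign]
  by_cases htwo : ∃ u ∈ L₀.map .inl, ∃ x ∈ L₀.map .inl, Point.sign G σ s u = -1 ∧
      Point.sign G σ s x = -1 ∧ x ≠ u ∧ x ≠ Point.mate G u
  · exact main [] 0 0 hn0 hn0 (Or.inl rfl) (Or.inr (by simpa using htwo))
  exfalso
  obtain ⟨u, hu, hσu⟩ : ∃ u ∈ L₀.map .inl, Point.sign G σ s u = -1 := by
    by_contra! hno
    apply h4
    have : negEnds (Point.sign G σ s) (L₀.map .inl) = 0 := by
      unfold negEnds
      rw [List.map_congr_left (g := fun _ => (0 : ℤ)) fun x hx => if_neg (hno x hx)]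
      simp [Function.comp_def]
    rw [this]
    exact dvd_zero 4
  obtain ⟨⟨f, x⟩, hfx, rfl⟩ := List.mem_map.1 hu
  obtain ⟨-, y, hf⟩ := (hL₀ f x).1 hfx
  rw [Point.sign_inl s hf] at hσu
  -- After switching, the edge `f` is the only negative edge of `G`: those of `H` are positive, and
  -- a second one outside `H` would contradict `htwo`.
  refine not_exists_unique_neg_of_flowAdmissible hV hE hadm s hf hσu fun f' x' y' hf' hne' => ?_
  by_cases hfH : f' ∈ E(H)
  · obtain ⟨t, ht, rfl⟩ := hEH f' hfH
    have hprod : σ (e t) * s (z t) * s (z (t + 1)) = 1 := by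
      rw [hstep t ht, hstep' (t + 1) ht, trailSign_succ]
      rcases units_int_cases (σ (e t)) with h | h <;>
        rcases units_int_cases (trailSign σ e t) with h' | h' <;> simp [h, h']
    rcases hf'.eq_and_eq_or_eq_and_eq (hHG.le.isLink_mono (h.link t ht)) with
      ⟨rfl, rfl⟩ | ⟨rfl, rfl⟩
    · exact hprod
    · rwa [mul_right_comm]
  · by_contra hcon
    refine htwo ⟨_, hu, .inl (f', x'), List.mem_map_of_mem ((hL₀ f' x').2
      ⟨⟨hf'.edge_mem, hfH⟩, hf'.inc_left⟩), by rw [Point.sign_inl s hf, hσu], ?_, ?_, ?_⟩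
    · rw [Point.sign_inl s hf']
      exact (units_int_cases _).resolve_left hcon
    · simp [hne']
    · rw [Point.mate_inl hf]
      simp [hne']

end SignedGraph

theorem theorem4p1 {α β : Type*} (G : Graph α β) [G.Loopless]
    (hV : V(G).Finite) (hE : E(G).Finite) (σ : β → ℤˣ)
    (hadm : SignedGraph.FlowAdmissible G σ)
    (hH : ∃ H : Graph α β, H ≤s G ∧ SignedGraph.IsEvenEulerian H σ) :
    SignedGraph.AdmitsNowhereZeroFlow G σ 6 := by
  obtain ⟨H, hHG, hH⟩ := hH
  exact SignedGraph.admitsNowhereZeroFlow_six hV hE hadm hHG hH
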